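/- Let $\Sigma$ be a compact connected orientable smooth surface without boundary of genus at least $2$. Then there is no $C^\infty$ Riemannian metric $g$ on the three-manifold $\Sigma \times S^1$ that is Sasakian and has no conjugate points. Here $g$ is *Sasakian* if there are a smooth $(1,1)$-tensor field $\varphi$, a smooth vector field $\xi$ (the Reeb field) and a smooth $1$-form $\eta$ such that $(\varphi,\xi,\eta,g)$ is a normal contact metric structure, that is, $\eta(\xi)=1$, $\varphi^2=-\mathrm{Id}+\eta\otimes\xi$, $g(\varphi X,\varphi Y)=g(X,Y)-\eta(X)\eta(Y)$, $d\eta(X,Y)=g(X,\varphi Y)$ and $[\varphi,\varphi]+2\,d\eta\otimes\xi=0$, with $2\,d\eta(X,Y)=X\eta(Y)-Y\eta(X)-\eta([X,Y])$ and $[\varphi,\varphi](X,Y)=\varphi^2[X,Y]+[\varphi X,\varphi Y]-\varphi[\varphi X,Y]-\varphi[X,\varphi Y]$. The metric $g$ *has no conjugate points* if along every geodesic $\gamma:\mathbb{R}\to\Sigma\times S^1$ of $g$ a Jacobi field that vanishes at two distinct parameters vanishes identically. -/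

import Mathlib

open scoped Manifold ContDiff Topology

noncomputable section

namespace RiemannianGeometry

open Bundle VectorField

section General

variable {E : Type*} [NormedAddCommGroup E] [NormedSpace ℝ E]
  {H : Type*} [TopologicalSpace H] {I : ModelWithCorners ℝ E H}
  {M : Type*} [TopologicalSpace M] [ChartedSpace H M] [IsManifold I ∞ M]

variable (I M) in
/-- A `C^∞` Riemannian metric on the manifold `M`. -/
abbrev SmoothMetric : Type _ :=
  ContMDiffRiemannianMetric I ∞ E (fun x : M ↦ TangentSpace I x)

variable (g : SmoothMetric I M)

theorem mdifferentiableAt_inner {X Y : ∀ x : M, TangentSpace I x} {x : M}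
    (hX : MDiffAt (T% X) x) (hY : MDiffAt (T% Y) x) :
    MDiffAt (fun y ↦ g.inner y (X y) (Y y)) x := by
  have h : MDifferentiableAt I (I.prod 𝓘(ℝ)) (fun m : M ↦
      TotalSpace.mk' ℝ (E := Bundle.Trivial M ℝ) m (g.inner m (X m) (Y m))) x := by
    apply MDifferentiableAt.clm_bundle_apply₂ (F₁ := E) (F₂ := E)
    · exact g.contMDiff.mdifferentiableAt (by simp)
    · exact hX
    · exact hY
  simp only [mdifferentiableAt_totalSpace] at h
  exact h.2

/-! ### The Levi-Civita connection, through the Koszul formula -/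

/-- Half of the right-hand side of the Koszul formula
`2 g(∇_X Y, Z) = X g(Y,Z) + Y g(X,Z) - Z g(X,Y) + g([X,Y],Z) - g([X,Z],Y) - g([Y,Z],X)`. -/
def koszul (Y X Z : ∀ x : M, TangentSpace I x) (x : M) : ℝ :=
  (1 / 2 : ℝ) * (mvfderiv I (fun y ↦ g.inner y (Y y) (Z y)) x (X x)
    + mvfderiv I (fun y ↦ g.inner y (X y) (Z y)) x (Y x)
    - mvfderiv I (fun y ↦ g.inner y (X y) (Y y)) x (Z x)
    + g.inner x (mlieBracket I X Y x) (Z x)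
    - g.inner x (mlieBracket I X Z x) (Y x)
    - g.inner x (mlieBracket I Y Z x) (X x))

variable [FiniteDimensional ℝ E]

theorem koszul_tensorial_left {Y Z : ∀ x : M, TangentSpace I x} {x : M}
    (hY : MDiffAt (T% Y) x) (hZ : MDiffAt (T% Z) x) :
    TensorialAt I E (fun X ↦ koszul g Y X Z x) x := by
  have : CompleteSpace E := FiniteDimensional.complete ℝ E
  constructor
  · intro f X hf hX
    have e1 : ∀ W : ∀ x : M, TangentSpace I x, (fun y ↦ g.inner y ((f • X) y) (W y))
        = fun y ↦ f y * g.inner y (X y) (W y) := by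
      intro W; ext y; simp
    simp only [koszul, e1, mvfderiv_fun_mul hf (mdifferentiableAt_inner g hX hZ),
      mvfderiv_fun_mul hf (mdifferentiableAt_inner g hX hY), mlieBracket_smul_left hf hX]
    simp [g.symm x (X x)]
    ring
  · intro X X' hX hX'
    have e1 : ∀ W : ∀ x : M, TangentSpace I x, (fun y ↦ g.inner y ((X + X') y) (W y))
        = fun y ↦ g.inner y (X y) (W y) + g.inner y (X' y) (W y) := by
      intro W; ext y; simp
    simp only [koszul, e1,
      mvfderiv_fun_add (mdifferentiableAt_inner g hX hZ) (mdifferentiableAt_inner g hX' hZ),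
      mvfderiv_fun_add (mdifferentiableAt_inner g hX hY) (mdifferentiableAt_inner g hX' hY),
      mlieBracket_add_left hX hX']
    simp
    ring

theorem koszul_tensorial_right {Y X : ∀ x : M, TangentSpace I x} {x : M}
    (hY : MDiffAt (T% Y) x) (hX : MDiffAt (T% X) x) :
    TensorialAt I E (fun Z ↦ koszul g Y X Z x) x := by
  have : CompleteSpace E := FiniteDimensional.complete ℝ E
  constructor
  · intro f Z hf hZ
    have e1 : ∀ W : ∀ x : M, TangentSpace I x, (fun y ↦ g.inner y (W y) ((f • Z) y))
        = fun y ↦ f y * g.inner y (W y) (Z y) := by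
      intro W; ext y; simp
    simp only [koszul, e1, mvfderiv_fun_mul hf (mdifferentiableAt_inner g hX hZ),
      mvfderiv_fun_mul hf (mdifferentiableAt_inner g hY hZ), mlieBracket_smul_right hf hZ]
    simp [g.symm x (Z x)]
    ring
  · intro Z Z' hZ hZ'
    have e1 : ∀ W : ∀ x : M, TangentSpace I x, (fun y ↦ g.inner y (W y) ((Z + Z') y))
        = fun y ↦ g.inner y (W y) (Z y) + g.inner y (W y) (Z' y) := by
      intro W; ext y; simp
    simp only [koszul, e1,
      mvfderiv_fun_add (mdifferentiableAt_inner g hX hZ) (mdifferentiableAt_inner g hX hZ'),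
      mvfderiv_fun_add (mdifferentiableAt_inner g hY hZ) (mdifferentiableAt_inner g hY hZ'),
      mlieBracket_add_right hZ hZ']
    simp
    ring

/-- The musical isomorphism `v ↦ g(v, ·)`. -/
def musical (x : M) : TangentSpace I x ≃ₗ[ℝ] (TangentSpace I x →L[ℝ] ℝ) :=
  haveI : FiniteDimensional ℝ (TangentSpace I x) := inferInstanceAs (FiniteDimensional ℝ E)
  haveI : T2Space (TangentSpace I x) := inferInstanceAs (T2Space E)
  ((g.inner x : TangentSpace I x →ₗ[ℝ] (TangentSpace I x →L[ℝ] ℝ))).linearEquivOfInjective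
    (by
      rw [← LinearMap.ker_eq_bot, LinearMap.ker_eq_bot']
      intro v hv
      by_contra h
      have h1 := g.pos x v h
      have h2 : g.inner x v = 0 := hv
      rw [h2] at h1
      simp at h1)
    (by
      rw [← (LinearMap.toContinuousLinearMap (𝕜 := ℝ) (E := TangentSpace I x)
        (F' := ℝ)).finrank_eq]
      exact (Subspace.dual_finrank_eq (K := ℝ) (V := TangentSpace I x)).symm)

theorem inner_musical_symm (x : M) (l : TangentSpace I x →L[ℝ] ℝ) (w : TangentSpace I x) :
    g.inner x ((musical g x).symm l) w = l w := by
  have h : musical g x ((musical g x).symm l) = l := (musical g x).apply_symm_apply l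
  exact congrArg (fun m : TangentSpace I x →L[ℝ] ℝ ↦ m w) h

open Classical in
/-- `leviCivitaFun g Y x` is the map `v ↦ ∇_v Y` at the point `x`, determined by the Koszul
formula; it is only meaningful if `Y` is differentiable at `x`. -/
def leviCivitaFun (Y : ∀ x : M, TangentSpace I x) (x : M) :
    TangentSpace I x →L[ℝ] TangentSpace I x :=
  haveI : FiniteDimensional ℝ (TangentSpace I x) := inferInstanceAs (FiniteDimensional ℝ E)
  haveI : T2Space (TangentSpace I x) := inferInstanceAs (T2Space E)
  if hY : MDiffAt (T% Y) x then
    LinearMap.toContinuousLinearMap ((musical g x).symm.toLinearMap ∘ₗ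
      (TensorialAt.mkHom₂ (F := E) (F' := E) (I := I) (fun X Z ↦ koszul g Y X Z x) x
        (fun _ hZ ↦ koszul_tensorial_left g hY hZ)
        (fun _ hX ↦ koszul_tensorial_right g hY hX)).toLinearMap)
  else 0

theorem inner_leviCivitaFun {Y X Z : ∀ x : M, TangentSpace I x} {x : M} (hY : MDiffAt (T% Y) x)
    (hX : MDiffAt (T% X) x) (hZ : MDiffAt (T% Z) x) :
    g.inner x (leviCivitaFun g Y x (X x)) (Z x) = koszul g Y X Z x := by
  rw [leviCivitaFun, dif_pos hY]
  refine (inner_musical_symm g x _ (Z x)).trans ?_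
  exact TensorialAt.mkHom₂_apply (F := E) (F' := E) (I := I)
    (Φ := fun X Z ↦ koszul g Y X Z x) (fun _ hZ ↦ koszul_tensorial_left g hY hZ)
    (fun _ hX ↦ koszul_tensorial_right g hY hX) hX hZ

theorem eq_of_inner_eq {x : M} {v w : TangentSpace I x}
    (h : ∀ Z : ∀ x : M, TangentSpace I x, MDiffAt (T% Z) x →
      g.inner x v (Z x) = g.inner x w (Z x)) : v = w := by
  refine (musical g x).injective ?_
  ext z
  have := h (FiberBundle.extend E z) (FiberBundle.mdifferentiableAt_extend ..)
  rw [FiberBundle.extend_apply_self] at this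
  exact this

/-- The Levi-Civita connection of a smooth Riemannian metric. -/
def leviCivita : CovariantDerivative I E (fun x : M ↦ TangentSpace I x) where
  toFun := leviCivitaFun g
  isCovariantDerivativeOnUniv := by
    have : CompleteSpace E := FiniteDimensional.complete ℝ E
    constructor
    · intro Y Y' x hY hY' _
      have hadd : MDiffAt (T% (Y + Y')) x := mdifferentiableAt_add_section hY hY'
      ext v
      refine eq_of_inner_eq g fun Z hZ ↦ ?_
      have hX := FiberBundle.mdifferentiableAt_extend I E (x := x) v
      have hv : FiberBundle.extend E v x = v := FiberBundle.extend_apply_self E v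
      generalize FiberBundle.extend E v = X at hX hv
      subst hv
      rw [add_apply, map_add, add_apply,
        inner_leviCivitaFun g hadd hX hZ,
        inner_leviCivitaFun g hY hX hZ, inner_leviCivitaFun g hY' hX hZ]
      have e1 : ∀ W : ∀ x : M, TangentSpace I x, (fun y ↦ g.inner y (W y) ((Y + Y') y))
          = fun y ↦ g.inner y (W y) (Y y) + g.inner y (W y) (Y' y) := by
        intro W; ext y; simp
      have e2 : ∀ W : ∀ x : M, TangentSpace I x, (fun y ↦ g.inner y ((Y + Y') y) (W y))
          = fun y ↦ g.inner y (Y y) (W y) + g.inner y (Y' y) (W y) := by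
        intro W; ext y; simp
      simp only [koszul, e1, e2,
        mvfderiv_fun_add (mdifferentiableAt_inner g hX hY) (mdifferentiableAt_inner g hX hY'),
        mvfderiv_fun_add (mdifferentiableAt_inner g hY hZ) (mdifferentiableAt_inner g hY' hZ),
        mlieBracket_add_right hY hY', mlieBracket_add_left hY hY']
      simp
      ring
    · intro Y f x hY hf _
      have hsmul : MDiffAt (T% (f • Y)) x := hf.smul_section hY
      ext v
      refine eq_of_inner_eq g fun Z hZ ↦ ?_
      have hX := FiberBundle.mdifferentiableAt_extend I E (x := x) v
      have hv : FiberBundle.extend E v x = v := FiberBundle.extend_apply_self E v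
      generalize FiberBundle.extend E v = X at hX hv
      subst hv
      have e1 : ∀ W : ∀ x : M, TangentSpace I x, (fun y ↦ g.inner y (W y) ((f • Y) y))
          = fun y ↦ f y * g.inner y (W y) (Y y) := by
        intro W; ext y; simp
      have e2 : ∀ W : ∀ x : M, TangentSpace I x, (fun y ↦ g.inner y ((f • Y) y) (W y))
          = fun y ↦ f y * g.inner y (Y y) (W y) := by
        intro W; ext y; simp
      rw [add_apply, map_add, add_apply,
        inner_leviCivitaFun g hsmul hX hZ, smul_apply, map_smul,
        smul_apply, inner_leviCivitaFun g hY hX hZ]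
      simp only [koszul, e1, e2, mvfderiv_fun_mul hf (mdifferentiableAt_inner g hX hY),
        mvfderiv_fun_mul hf (mdifferentiableAt_inner g hY hZ), mlieBracket_smul_right hf hY,
        mlieBracket_smul_left hf hY]
      simp [g.symm x (Y x)]
      ring

/-- The Levi-Civita connection is compatible with the metric. -/
theorem leviCivita_metric {X Y Z : ∀ x : M, TangentSpace I x} {x : M}
    (hX : MDiffAt (T% X) x) (hY : MDiffAt (T% Y) x) (hZ : MDiffAt (T% Z) x) :
    mvfderiv I (fun y ↦ g.inner y (Y y) (Z y)) x (X x)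
      = g.inner x (leviCivita g Y x (X x)) (Z x) + g.inner x (Y x) (leviCivita g Z x (X x)) := by
  have h1 : g.inner x (leviCivita g Y x (X x)) (Z x) = koszul g Y X Z x := inner_leviCivitaFun g hY hX hZ
  have h2 : g.inner x (leviCivita g Z x (X x)) (Y x) = koszul g Z X Y x := inner_leviCivitaFun g hZ hX hY
  rw [g.symm x (Y x), h1, h2]
  have e : (fun y ↦ g.inner y (Z y) (Y y)) = fun y ↦ g.inner y (Y y) (Z y) := by
    ext y; exact g.symm y _ _
  simp only [koszul, e, mlieBracket_swap_apply (V := Z) (W := Y), map_neg,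
    neg_apply]
  ring

/-- The Levi-Civita connection is torsion-free. -/
theorem leviCivita_torsion {X Y : ∀ x : M, TangentSpace I x} {x : M}
    (hX : MDiffAt (T% X) x) (hY : MDiffAt (T% Y) x) :
    leviCivita g Y x (X x) - leviCivita g X x (Y x) = mlieBracket I X Y x := by
  refine eq_of_inner_eq g fun Z hZ ↦ ?_
  have h1 : g.inner x (leviCivita g Y x (X x)) (Z x) = koszul g Y X Z x := inner_leviCivitaFun g hY hX hZ
  have h2 : g.inner x (leviCivita g X x (Y x)) (Z x) = koszul g X Y Z x := inner_leviCivitaFun g hX hY hZ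
  rw [map_sub, sub_apply, h1, h2]
  have e : (fun y ↦ g.inner y (Y y) (X y)) = fun y ↦ g.inner y (X y) (Y y) := by
    ext y; exact g.symm y _ _
  simp only [koszul, e, mlieBracket_swap_apply (V := Y) (W := X), map_neg,
    neg_apply]
  ring

/-! ### Curvature, geodesics, Jacobi fields, conjugate points -/

/-- The Riemann curvature tensor `R(u, v) w`, where
`R(X, Y) Z = ∇_X ∇_Y Z - ∇_Y ∇_X Z - ∇_{[X, Y]} Z`, evaluated at the point `x` on vector fields
extending `u`, `v`, `w` smoothly near `x`. -/
def curvature (x : M) (u v w : TangentSpace I x) : TangentSpace I x :=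
  let X : ∀ y : M, TangentSpace I y := FiberBundle.extend E u
  let Y : ∀ y : M, TangentSpace I y := FiberBundle.extend E v
  let Z : ∀ y : M, TangentSpace I y := FiberBundle.extend E w
  leviCivita g (fun y ↦ leviCivita g Z y (Y y)) x u
    - leviCivita g (fun y ↦ leviCivita g Z y (X y)) x v
    - leviCivita g Z x (mlieBracket I X Y x)

variable (I) in
/-- The velocity of a curve. -/
def velocity (γ : ℝ → M) (t : ℝ) : TangentSpace I (γ t) :=
  mfderiv 𝓘(ℝ, ℝ) I γ t (1 : ℝ)

/-- The covariant derivative `(D V / dt)(t)` of a vector field `V` along a curve `γ`. If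
`V = ∑ i, V^i e_i(γ)` in the local frame `e` that the chart at `γ t` induces, this is
`∑ i, (V^i)'(t) e_i + ∑ i, V^i(t) ∇_{γ'(t)} e_i`. -/
def covDerivAlong (γ : ℝ → M) (V : ∀ t, TangentSpace I (γ t)) (t : ℝ) : TangentSpace I (γ t) :=
  (trivializationAt E (fun x : M ↦ TangentSpace I x) (γ t)).symm (γ t)
      (deriv (fun s ↦ (trivializationAt E (fun x : M ↦ TangentSpace I x) (γ t)
        ⟨γ s, V s⟩).2) t)
    + leviCivita g (FiberBundle.extend E (V t)) (γ t) (velocity I γ t)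

/-- `γ : ℝ → M` is a geodesic: `D γ' / dt = 0`. -/
def IsGeodesic (γ : ℝ → M) : Prop :=
  ContMDiff 𝓘(ℝ, ℝ) I 2 γ ∧ ∀ t, covDerivAlong g γ (velocity I γ) t = 0

/-- `J` is a Jacobi field along `γ`: `D² J / dt² + R(J, γ') γ' = 0`. -/
def IsJacobiField (γ : ℝ → M) (J : ∀ t, TangentSpace I (γ t)) : Prop :=
  ContMDiff 𝓘(ℝ, ℝ) I.tangent 2 (fun t ↦ (⟨γ t, J t⟩ : TangentBundle I M)) ∧
    ∀ t, covDerivAlong g γ (covDerivAlong g γ J) t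
      + curvature g (γ t) (J t) (velocity I γ t) (velocity I γ t) = 0

/-- The parameters `a ≠ b` are conjugate along the geodesic `γ` if some Jacobi field along `γ`
that is not identically zero vanishes at both. -/
def AreConjugate (γ : ℝ → M) (a b : ℝ) : Prop :=
  a ≠ b ∧ ∃ J : ∀ t, TangentSpace I (γ t),
    IsJacobiField g γ J ∧ (∃ t, J t ≠ 0) ∧ J a = 0 ∧ J b = 0

/-- The (complete) metric `g` has no conjugate points. -/
def NoConjugatePoints : Prop :=
  ∀ γ : ℝ → M, IsGeodesic g γ → ∀ a b : ℝ, ¬ AreConjugate g γ a b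

/-! ### Sasakian metrics -/

/-- The exterior derivative `dη(X, Y) = X(η(Y)) - Y(η(X)) - η([X, Y])` of a 1-form. -/
def extDeriv (η : ∀ x : M, TangentSpace I x →L[ℝ] ℝ) (X Y : ∀ x : M, TangentSpace I x)
    (x : M) : ℝ :=
  mvfderiv I (fun y ↦ η y (Y y)) x (X x) - mvfderiv I (fun y ↦ η y (X y)) x (Y x)
    - η x (mlieBracket I X Y x)

/-- The Nijenhuis torsion
`[φ, φ](X, Y) = φ² [X, Y] + [φ X, φ Y] - φ [φ X, Y] - φ [X, φ Y]`. -/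
def nijenhuis (φ : ∀ x : M, TangentSpace I x →L[ℝ] TangentSpace I x)
    (X Y : ∀ x : M, TangentSpace I x) (x : M) : TangentSpace I x :=
  φ x (φ x (mlieBracket I X Y x))
    + mlieBracket I (fun y ↦ φ y (X y)) (fun y ↦ φ y (Y y)) x
    - φ x (mlieBracket I (fun y ↦ φ y (X y)) Y x)
    - φ x (mlieBracket I X (fun y ↦ φ y (Y y)) x)

/-- A Sasakian structure with metric `g`: a normal contact metric structure `(φ, ξ, η, g)`.
The field `xi` is the Reeb field. The factors are those of the convention in which
the `2`-form `dη(X, Y) = (1/2) (X(η(Y)) - Y(η(X)) - η([X, Y]))` equals `g(X, φ Y)` and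
normality is `[φ, φ] + 2 dη ⊗ ξ = 0`; note that `extDeriv` has no factor `1/2`. -/
structure SasakianStructure where
  /-- the structure tensor -/
  phi : ∀ x : M, TangentSpace I x →L[ℝ] TangentSpace I x
  /-- the Reeb vector field -/
  xi : ∀ x : M, TangentSpace I x
  /-- the contact form -/
  eta : ∀ x : M, TangentSpace I x →L[ℝ] ℝ
  phi_smooth : ContMDiff I (I.prod 𝓘(ℝ, E →L[ℝ] E)) ∞
    (fun x ↦ TotalSpace.mk' (E →L[ℝ] E) x (phi x))
  xi_smooth : ContMDiff I I.tangent ∞ (fun x ↦ (⟨x, xi x⟩ : TangentBundle I M))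
  eta_smooth : ContMDiff I (I.prod 𝓘(ℝ, E →L[ℝ] ℝ)) ∞
    (fun x ↦ TotalSpace.mk' (E →L[ℝ] ℝ) x (eta x))
  eta_xi : ∀ x, eta x (xi x) = 1
  phi_phi : ∀ x v, phi x (phi x v) = -v + eta x v • xi x
  compatible : ∀ x v w, g.inner x (phi x v) (phi x w) = g.inner x v w - eta x v * eta x w
  contact : ∀ (X Y : ∀ x : M, TangentSpace I x) (x : M), MDiffAt (T% X) x → MDiffAt (T% Y) x →
    (1 / 2 : ℝ) * extDeriv eta X Y x = g.inner x (X x) (phi x (Y x))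
  normal : ∀ (X Y : ∀ x : M, TangentSpace I x) (x : M), MDiffAt (T% X) x → MDiffAt (T% Y) x →
    nijenhuis phi X Y x + extDeriv eta X Y x • xi x = 0

/-- The metric `g` is Sasakian if it is the metric of some Sasakian structure. -/
def IsSasakian : Prop := Nonempty (SasakianStructure g)

end General

/-! ### Orientable surfaces and their genus -/

/-- A smooth `n`-manifold is orientable if it is covered by charts of its smooth structure
whose coordinate changes have positive Jacobian determinant. -/
def IsOrientable (n : ℕ) (M : Type*) [TopologicalSpace M]
    [ChartedSpace (EuclideanSpace ℝ (Fin n)) M] [IsManifold (𝓡 n) ∞ M] : Prop :=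
  ∃ A : Set (OpenPartialHomeomorph M (EuclideanSpace ℝ (Fin n))),
    A ⊆ IsManifold.maximalAtlas (𝓡 n) ∞ M ∧ (∀ x : M, ∃ e ∈ A, x ∈ e.source) ∧
    ∀ e ∈ A, ∀ e' ∈ A, ∀ y ∈ (e.symm.trans e').source, 0 < (fderiv ℝ (e.symm.trans e') y).det

universe u

/-- The closed connected orientable surface `S` has genus `k`: its first singular homology with
rational coefficients has dimension `2 k`. -/
def HasGenus (S : Type u) [TopologicalSpace S] (k : ℕ) : Prop :=
  Module.finrank ℚ (((AlgebraicTopology.singularHomologyFunctor.{u} (ModuleCat.{u} ℚ) 1).obj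
    (ModuleCat.of ℚ (ULift.{u} ℚ))).obj (TopCat.of S)) = 2 * k

end RiemannianGeometry

end

/-! The obstruction is the Reeb field: its orbits are geodesics that carry conjugate points. A
Sasakian metric satisfies `∇ξ = -φ`, hence `∇_ξ ξ = 0`, and `R(v, ξ) ξ = v - η(v) ξ`, so every plane
containing `ξ` has sectional curvature 1. Along a Reeb orbit take a parallel field `V` that is
nonzero and orthogonal to `ξ`. Then `J = sin t • V` satisfies `J'' = -J` and `R(J, ξ) ξ = J`, so it
is a nontrivial Jacobi field vanishing at `0` and `π`.

The curvature identity (`curvature_xi`) rests on two invariances under the Reeb flow: that of `dη`,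
and that of `φ`, which comes from normality. Together they make `ξ` a Killing field, and then `dη =
2 g(·, φ ·)` determines `∇ξ`. Compactness makes the Reeb orbits complete
(`exists_isMIntegralCurve_of_compactSpace`), and it bounds the coefficients of the linear equation
of parallel transport (`exists_parallel`). The two sides meet in `exists_areConjugate`. -/

open scoped Manifold ContDiff Topology

noncomputable section

namespace RiemannianGeometry

open Bundle VectorField

/-! ### Smooth vector fields, their brackets and their action on functions -/

section SmoothFields

variable {E : Type*} [NormedAddCommGroup E] [NormedSpace ℝ E]
  {H : Type*} [TopologicalSpace H] {I : ModelWithCorners ℝ E H}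
  {M : Type*} [TopologicalSpace M] [ChartedSpace H M] {x : M} {f : M → ℝ}

theorem mvfderiv_congr {F : Type*} [NormedAddCommGroup F] [NormedSpace ℝ F] {f f' : M → F}
    (h : f =ᶠ[𝓝 x] f') : mvfderiv I f x = mvfderiv I f' x := by
  ext v
  simp only [mvfderiv, h.mfderiv_eq]
  rfl

variable [IsManifold I ∞ M]

/-- The vector field `X` is `C^∞` at the point `x`. -/
abbrev SmoothAt (X : ∀ x : M, TangentSpace I x) (x : M) : Prop :=
  ContMDiffAt I I.tangent ∞ (fun y ↦ (⟨y, X y⟩ : TangentBundle I M)) x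

variable {X Y Z W : ∀ x : M, TangentSpace I x}

theorem SmoothAt.mdiffAt (hX : SmoothAt X x) : MDiffAt (T% X) x :=
  ContMDiffAt.mdifferentiableAt hX (by simp)

theorem eventually_mdifferentiableAt_of_contMDiffAt (hf : ContMDiffAt I 𝓘(ℝ) ∞ f x) :
    ∀ᶠ y in 𝓝 x, MDiffAt f y := by
  have h : ContMDiffAt I 𝓘(ℝ) 1 f x := hf.of_le (by simp)
  filter_upwards [(contMDiffAt_iff_contMDiffAt_nhds (by simp)).1 h] with y hy
  exact hy.mdifferentiableAt (by simp)

theorem SmoothAt.eventually_mdiffAt (hX : SmoothAt X x) : ∀ᶠ y in 𝓝 x, MDiffAt (T% X) y := by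
  have h : ContMDiffAt I I.tangent 1 (fun y ↦ (⟨y, X y⟩ : TangentBundle I M)) x :=
    ContMDiffAt.of_le hX (by simp)
  filter_upwards [(contMDiffAt_iff_contMDiffAt_nhds (by simp)).1 h] with y hy
  exact hy.mdifferentiableAt (by simp)

theorem smoothAt_extend (v : TangentSpace I x) :
    SmoothAt (FiberBundle.extend E v : ∀ y : M, TangentSpace I y) x :=
  FiberBundle.contMDiffAt_extend I E v

theorem SmoothAt.inner (g : SmoothMetric I M) (hX : SmoothAt X x) (hY : SmoothAt Y x) :
    ContMDiffAt I 𝓘(ℝ) ∞ (fun y ↦ g.inner y (X y) (Y y)) x := by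
  have h : ContMDiffAt I (I.prod 𝓘(ℝ)) ∞ (fun m : M ↦
      TotalSpace.mk' ℝ (E := Bundle.Trivial M ℝ) m (g.inner m (X m) (Y m))) x := by
    apply ContMDiffAt.clm_bundle_apply₂ (F₁ := E) (F₂ := E)
    · exact g.contMDiff.contMDiffAt
    · exact hX
    · exact hY
  simp only [contMDiffAt_totalSpace] at h
  exact h.2

theorem SmoothAt.smul (hf : ContMDiffAt I 𝓘(ℝ) ∞ f x) (hX : SmoothAt X x) : SmoothAt (f • X) x :=
  ContMDiffAt.smul_section hf hX

theorem SmoothAt.sub (hX : SmoothAt X x) (hY : SmoothAt Y x) : SmoothAt (X - Y) x :=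
  ContMDiffAt.sub_section hX hY

variable [FiniteDimensional ℝ E]

theorem SmoothAt.mlieBracket (hX : SmoothAt X x) (hY : SmoothAt Y x) :
    SmoothAt (mlieBracket I X Y) x := by
  have : CompleteSpace E := FiniteDimensional.complete ℝ E
  have : IsManifold I (minSmoothness ℝ 2) M :=
    IsManifold.of_le (n := ∞) (by simpa using! WithTop.coe_le_coe.2 (le_top : (2 : ℕ∞) ≤ ⊤))
  have : IsManifold I (((⊤ : ℕ∞) : WithTop ℕ∞) + 1) M := IsManifold.of_le (n := ∞) (by simp)
  exact ContMDiffAt.mlieBracket_vectorField (m := ⊤) (n := ⊤) hX hY (by simp)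

theorem mlieBracket_leibniz (hX : SmoothAt X x) (hY : SmoothAt Y x) (hZ : SmoothAt Z x) :
    mlieBracket I X (mlieBracket I Y Z) x =
      mlieBracket I (mlieBracket I X Y) Z x + mlieBracket I Y (mlieBracket I X Z) x := by
  have : CompleteSpace E := FiniteDimensional.complete ℝ E
  have : IsManifold I (minSmoothness ℝ 3) M :=
    IsManifold.of_le (n := ∞) (by simpa using! WithTop.coe_le_coe.2 (le_top : (3 : ℕ∞) ≤ ⊤))
  have h : minSmoothness ℝ 2 ≤ (∞ : WithTop ℕ∞) := by
    simpa using! WithTop.coe_le_coe.2 (le_top : (2 : ℕ∞) ≤ ⊤)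
  exact leibniz_identity_mlieBracket_apply (ContMDiffAt.of_le hX h) (ContMDiffAt.of_le hY h)
    (ContMDiffAt.of_le hZ h)

variable [Nontrivial E]

/-- Brackets of smooth fields are smooth and `[X, f Z] - f [X, Z] = (X f) Z`. Pairing with a field
`Z` that is nonzero at `x` and dividing by `g(Z, Z)` isolates `X f`. -/
theorem contMDiffAt_mvfderiv (g : SmoothMetric I M) (hf : ContMDiffAt I 𝓘(ℝ) ∞ f x)
    (hX : SmoothAt X x) : ContMDiffAt I 𝓘(ℝ) ∞ (fun y ↦ mvfderiv I f y (X y)) x := by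
  have : CompleteSpace E := FiniteDimensional.complete ℝ E
  obtain ⟨v, hv⟩ := exists_ne (0 : E)
  let Z : ∀ y : M, TangentSpace I y := FiberBundle.extend E (x := x) (v : TangentSpace I x)
  have hZ : SmoothAt Z x := smoothAt_extend _
  have hZx : Z x = v := FiberBundle.extend_apply_self E _
  have hpos : g.inner x (Z x) (Z x) ≠ 0 := (g.pos x _ (by rw [hZx]; exact hv)).ne'
  have h1 : SmoothAt (VectorField.mlieBracket I X (f • Z) - f • VectorField.mlieBracket I X Z) x :=
    (hX.mlieBracket (hZ.smul hf)).sub ((hX.mlieBracket hZ).smul hf)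
  have h2 := (h1.inner g hZ).div₀ (hZ.inner g hZ) hpos
  refine h2.congr_of_eventuallyEq ?_
  have hne : ∀ᶠ y in 𝓝 x, g.inner y (Z y) (Z y) ≠ 0 :=
    (hZ.inner g hZ).continuousAt.eventually_ne hpos
  filter_upwards [hne, eventually_mdifferentiableAt_of_contMDiffAt hf, hZ.eventually_mdiffAt]
    with y hy hfy hZy
  have e : (VectorField.mlieBracket I X (f • Z) - f • VectorField.mlieBracket I X Z) y
      = mvfderiv I f y (X y) • Z y := by
    rw [Pi.sub_apply, mlieBracket_smul_right hfy hZy]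
    exact add_sub_cancel_right _ _
  simp only [Pi.div_apply, e, map_smul, smul_apply, smul_eq_mul]
  field_simp

/-- The Jacobi identity for `X`, `Y`, `f Z` with `Z x ≠ 0` contains this one: the terms with a
single derivative of `f` are symmetric in `X` and `Y`, those with `f` undifferentiated cancel by the
Jacobi identity for `X`, `Y`, `Z`, and the coefficient of `Z` remains. -/
theorem mvfderiv_mlieBracket (g : SmoothMetric I M) (hf : ContMDiffAt I 𝓘(ℝ) ∞ f x)
    (hX : SmoothAt X x) (hY : SmoothAt Y x) :
    mvfderiv I f x (mlieBracket I X Y x) =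
      mvfderiv I (fun y ↦ mvfderiv I f y (Y y)) x (X x)
        - mvfderiv I (fun y ↦ mvfderiv I f y (X y)) x (Y x) := by
  have : CompleteSpace E := FiniteDimensional.complete ℝ E
  obtain ⟨v, hv⟩ := exists_ne (0 : E)
  let Z : ∀ y : M, TangentSpace I y := FiberBundle.extend E (x := x) (v : TangentSpace I x)
  have hZ : SmoothAt Z x := smoothAt_extend _
  have hZx : Z x ≠ 0 := by
    have : Z x = v := FiberBundle.extend_apply_self E _
    rw [this]; exact hv
  have key : ∀ {X Y : ∀ y : M, TangentSpace I y}, SmoothAt X x → SmoothAt Y x →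
      VectorField.mlieBracket I X (VectorField.mlieBracket I Y (f • Z)) x =
      mvfderiv I (fun y ↦ mvfderiv I f y (Y y)) x (X x) • Z x
      + mvfderiv I f x (Y x) • VectorField.mlieBracket I X Z x
      + mvfderiv I f x (X x) • VectorField.mlieBracket I Y Z x
      + f x • VectorField.mlieBracket I X (VectorField.mlieBracket I Y Z) x := by
    intro X Y hX hY
    have e : VectorField.mlieBracket I Y (f • Z) =ᶠ[𝓝 x]
        ((fun y ↦ mvfderiv I f y (Y y)) • Z + f • VectorField.mlieBracket I Y Z) := by
      filter_upwards [eventually_mdifferentiableAt_of_contMDiffAt hf, hZ.eventually_mdiffAt]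
        with y hfy hZy
      rw [mlieBracket_smul_right hfy hZy]; rfl
    have hd := contMDiffAt_mvfderiv g hf hY
    rw [Filter.EventuallyEq.mlieBracket_vectorField_eq (Filter.EventuallyEq.refl _ X) e,
      mlieBracket_add_right (hZ.smul hd).mdiffAt ((hY.mlieBracket hZ).smul hf).mdiffAt,
      mlieBracket_smul_right (hd.mdifferentiableAt (by simp)) hZ.mdiffAt,
      mlieBracket_smul_right (hf.mdifferentiableAt (by simp)) (hY.mlieBracket hZ).mdiffAt]
    abel
  have h := mlieBracket_leibniz hX hY (hZ.smul hf)
  rw [key hX hY, key hY hX, mlieBracket_smul_right (hf.mdifferentiableAt (by simp)) hZ.mdiffAt,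
    mlieBracket_leibniz hX hY hZ] at h
  refine smul_left_injective ℝ hZx ?_
  simp only [sub_smul]
  rw [smul_add] at h
  have h' := sub_eq_zero.2 h
  rw [← sub_eq_zero, ← neg_eq_zero, ← h']
  abel

end SmoothFields

/-! ### Smoothness of the Levi-Civita connection, symmetries of the curvature -/

section LeviCivitaSmooth

variable {E : Type*} [NormedAddCommGroup E] [NormedSpace ℝ E]
  {H : Type*} [TopologicalSpace H] {I : ModelWithCorners ℝ E H}
  {M : Type*} [TopologicalSpace M] [ChartedSpace H M] [IsManifold I ∞ M]
  {X Y Z W : ∀ x : M, TangentSpace I x} {x : M} [FiniteDimensional ℝ E]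

/-- A vector field whose inner products with all smooth vector fields are smooth is smooth. -/
theorem smoothAt_of_inner (g : SmoothMetric I M)
    (h : ∀ Z : ∀ y : M, TangentSpace I y, SmoothAt Z x →
      ContMDiffAt I 𝓘(ℝ) ∞ (fun y ↦ g.inner y (W y) (Z y)) x) : SmoothAt W x := by
  have : CompleteSpace E := FiniteDimensional.complete ℝ E
  let t := trivializationAt E (fun y : M ↦ TangentSpace I y) x
  have hx : x ∈ t.baseSet := FiberBundle.mem_baseSet_trivializationAt' x
  let b := Module.finBasis ℝ E
  let β : Fin (Module.finrank ℝ E) → (E →L[ℝ] ℝ) := fun i ↦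
    LinearMap.toContinuousLinearMap (b.coord i)
  let e : Fin (Module.finrank ℝ E) → ∀ y : M, TangentSpace I y := fun i ↦
    FiberBundle.extend E (t.symm x (b i))
  have he : ∀ i, SmoothAt (e i) x := fun i ↦ smoothAt_extend _
  have heq : ∀ i y, e i y = t.symm y (b i) := by
    intro i y
    simp only [e, FiberBundle.extend]
    rw [t.apply_mk_symm hx]
  -- `B y` is the Gram form of the metric in the frame `e`, and `l y` below collects the products of
  -- `W` with the frame. The coordinates of `W` solve `B y u = l y`, so they are smooth because
  -- inversion of operators is.
  let B : M → (E →L[ℝ] E →L[ℝ] ℝ) := fun y ↦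
    ∑ i, ∑ j, g.inner y (e i y) (e j y) • (β i).smulRight (β j)
  have hsum : ∀ (u : E), u = ∑ i, β i u • b i := fun u ↦ (b.sum_repr u).symm
  have hsymm : ∀ y, ∀ u : E, y ∈ t.baseSet → t.symmL ℝ y u = ∑ i, β i u • e i y := by
    intro y u hy
    conv_lhs => rw [hsum u]
    simp [map_sum, heq, Trivialization.symmL_apply, hy]
  have hB : ∀ y ∈ t.baseSet, ∀ u v : E,
      B y u v = g.inner y (t.symmL ℝ y u) (t.symmL ℝ y v) := by
    intro y hy u v
    rw [hsymm y u hy, hsymm y v hy]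
    simp only [B, map_sum, map_smul, sum_apply, smul_apply,
      ContinuousLinearMap.smulRight_apply, smul_eq_mul, Finset.mul_sum]
    rw [Finset.sum_comm]
    refine Finset.sum_congr rfl fun i _ ↦ Finset.sum_congr rfl fun j _ ↦ ?_
    ring
  have hBsmooth : ContMDiffAt I 𝓘(ℝ, E →L[ℝ] E →L[ℝ] ℝ) ∞ B x := by
    refine ContMDiffAt.sum fun i _ ↦ ContMDiffAt.sum fun j _ ↦ ?_
    exact ((he i).inner g (he j)).smul contMDiffAt_const
  let l : M → (E →L[ℝ] ℝ) := fun y ↦ ∑ j, g.inner y (W y) (e j y) • β j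
  have hl : ContMDiffAt I 𝓘(ℝ, E →L[ℝ] ℝ) ∞ l x :=
    ContMDiffAt.sum fun j _ ↦ (h _ (he j)).smul contMDiffAt_const
  have hinj : ∀ y ∈ t.baseSet, ∀ u, B y u = 0 → u = 0 := by
    intro y hy u hu
    by_contra hne
    have h0 : t.symmL ℝ y u ≠ 0 := by
      intro h0
      have := t.continuousLinearMapAt_symmL (R := ℝ) hy u
      rw [h0, map_zero] at this
      exact hne this.symm
    have := g.pos y _ h0
    rw [← hB y hy u u, hu] at this
    simp at this
  have hequiv : ∀ y ∈ t.baseSet, ∃ A : E ≃L[ℝ] (E →L[ℝ] ℝ), (A : E →L[ℝ] (E →L[ℝ] ℝ)) = B y := by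
    intro y hy
    refine ⟨((B y).toLinearMap.linearEquivOfInjective ?_ ?_).toContinuousLinearEquiv, ?_⟩
    · rw [← LinearMap.ker_eq_bot, LinearMap.ker_eq_bot']
      exact hinj y hy
    · rw [← (LinearMap.toContinuousLinearMap (𝕜 := ℝ) (E := E) (F' := ℝ)).finrank_eq]
      exact (Subspace.dual_finrank_eq (K := ℝ) (V := E)).symm
    · ext u v; rfl
  have hinv : ContMDiffAt I 𝓘(ℝ, (E →L[ℝ] ℝ) →L[ℝ] E) ∞ (fun y ↦ (B y).inverse) x := by
    obtain ⟨A, hA⟩ := hequiv x hx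
    have h1 : ContDiffAt ℝ ∞ ContinuousLinearMap.inverse (B x) := by
      rw [← hA]; exact contDiffAt_map_inverse A
    exact h1.contMDiffAt.comp x hBsmooth
  have hfin : ContMDiffAt I 𝓘(ℝ, E) ∞ (fun y ↦ (B y).inverse (l y)) x := hinv.clm_apply hl
  refine (contMDiffAt_section x).2 (hfin.congr_of_eventuallyEq ?_)
  filter_upwards [t.open_baseSet.mem_nhds hx] with y hy
  obtain ⟨A, hA⟩ := hequiv y hy
  have hu : B y (t ⟨y, W y⟩).2 = l y := by
    ext v
    rw [hB y hy, ← Trivialization.continuousLinearMapAt_apply_of_mem (R := ℝ) t hy,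
      t.symmL_continuousLinearMapAt hy, hsymm y v hy]
    simp only [l, map_sum, map_smul, sum_apply, smul_apply, smul_eq_mul]
    exact Finset.sum_congr rfl fun i _ ↦ mul_comm _ _
  change (t ⟨y, W y⟩).2 = _
  rw [← hu, ← hA, ContinuousLinearMap.inverse_equiv]
  exact (A.symm_apply_apply _).symm

variable (g : SmoothMetric I M)

theorem inner_leviCivita (hX : MDiffAt (T% X) x) (hY : MDiffAt (T% Y) x) (hZ : MDiffAt (T% Z) x) :
    g.inner x (leviCivita g Y x (X x)) (Z x) = koszul g Y X Z x :=
  inner_leviCivitaFun g hY hX hZ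

variable [Nontrivial E]

theorem contMDiffAt_koszul (hX : SmoothAt X x) (hY : SmoothAt Y x) (hZ : SmoothAt Z x) :
    ContMDiffAt I 𝓘(ℝ) ∞ (koszul g Y X Z) x := by
  have hd := fun {A B C : ∀ x : M, TangentSpace I x} (hA : SmoothAt A x) (hB : SmoothAt B x)
    (hC : SmoothAt C x) ↦ contMDiffAt_mvfderiv g (hA.inner g hB) hC
  exact contMDiffAt_const.mul (((((hd hY hZ hX).add (hd hX hZ hY)).sub (hd hX hY hZ)).add
    ((hX.mlieBracket hY).inner g hZ)).sub ((hX.mlieBracket hZ).inner g hY) |>.sub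
      ((hY.mlieBracket hZ).inner g hX))

theorem SmoothAt.leviCivita (hX : SmoothAt X x) (hY : SmoothAt Y x) :
    SmoothAt (fun y ↦ leviCivita g Y y (X y)) x := by
  refine smoothAt_of_inner g fun Z hZ ↦ ?_
  refine (contMDiffAt_koszul g hX hY hZ).congr_of_eventuallyEq ?_
  filter_upwards [hX.eventually_mdiffAt, hY.eventually_mdiffAt, hZ.eventually_mdiffAt]
    with y h1 h2 h3 using inner_leviCivita g h1 h2 h3

/-- The Riemann curvature `∇_X ∇_Y Z - ∇_Y ∇_X Z - ∇_{[X, Y]} Z` of vector fields. -/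
def curvatureField (X Y Z : ∀ x : M, TangentSpace I x) (x : M) : TangentSpace I x :=
  leviCivita g (fun y ↦ leviCivita g Z y (Y y)) x (X x)
    - leviCivita g (fun y ↦ leviCivita g Z y (X y)) x (Y x)
    - leviCivita g Z x (mlieBracket I X Y x)

/-- Apply `[X, Y] = X Y - Y X` to the function `g(Z, W)` and expand both second derivatives by
metric compatibility; the mixed terms are symmetric in `X` and `Y` and cancel. -/
theorem inner_curvatureField_skew (hX : SmoothAt X x) (hY : SmoothAt Y x) (hZ : SmoothAt Z x)
    (hW : SmoothAt W x) :
    g.inner x (curvatureField g X Y Z x) (W x) = - g.inner x (Z x) (curvatureField g X Y W x) := by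
  have key : ∀ {X Y : ∀ x : M, TangentSpace I x}, SmoothAt X x → SmoothAt Y x →
      mvfderiv I (fun y ↦ mvfderiv I (fun z ↦ g.inner z (Z z) (W z)) y (Y y)) x (X x) =
      g.inner x (leviCivita g (fun y ↦ leviCivita g Z y (Y y)) x (X x)) (W x)
      + g.inner x (leviCivita g Z x (Y x)) (leviCivita g W x (X x))
      + (g.inner x (leviCivita g Z x (X x)) (leviCivita g W x (Y x))
      + g.inner x (Z x) (leviCivita g (fun y ↦ leviCivita g W y (Y y)) x (X x))) := by
    intro X Y hX hY
    have hYZ := SmoothAt.leviCivita g hY hZ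
    have hYW := SmoothAt.leviCivita g hY hW
    have e : (fun y ↦ mvfderiv I (fun z ↦ g.inner z (Z z) (W z)) y (Y y)) =ᶠ[𝓝 x]
        fun y ↦ g.inner y (leviCivita g Z y (Y y)) (W y)
          + g.inner y (Z y) (leviCivita g W y (Y y)) := by
      filter_upwards [hY.eventually_mdiffAt, hZ.eventually_mdiffAt, hW.eventually_mdiffAt]
        with y h1 h2 h3 using leviCivita_metric g h1 h2 h3
    rw [mvfderiv_congr e, mvfderiv_fun_add (mdifferentiableAt_inner g hYZ.mdiffAt hW.mdiffAt)
      (mdifferentiableAt_inner g hZ.mdiffAt hYW.mdiffAt), add_apply,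
      leviCivita_metric g hX.mdiffAt hYZ.mdiffAt hW.mdiffAt,
      leviCivita_metric g hX.mdiffAt hZ.mdiffAt hYW.mdiffAt]
  have h := mvfderiv_mlieBracket g (hZ.inner g hW) hX hY
  rw [key hX hY, key hY hX, leviCivita_metric g (hX.mlieBracket hY).mdiffAt hZ.mdiffAt
    hW.mdiffAt] at h
  simp only [curvatureField, map_sub, sub_apply]
  linarith

/-- The curvature is tensorial in its last argument. -/
theorem curvatureField_congr_right (hX : SmoothAt X x) (hY : SmoothAt Y x) (hZ : SmoothAt Z x)
    (hW : SmoothAt W x) (h : Z x = W x) : curvatureField g X Y Z x = curvatureField g X Y W x := by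
  have key : ∀ v : TangentSpace I x,
      g.inner x (curvatureField g X Y Z x) v = g.inner x (curvatureField g X Y W x) v := by
    intro v
    have hV := smoothAt_extend (I := I) v
    have hv : FiberBundle.extend E v x = v := FiberBundle.extend_apply_self E v
    -- Skew-symmetry moves `Z` out of the differentiated slot into a pointwise product, which sees
    -- only `Z x`.
    have h1 := inner_curvatureField_skew g hX hY hZ hV
    have h2 := inner_curvatureField_skew g hX hY hW hV
    rw [hv] at h1 h2
    rw [h1, h2, h]
  exact eq_of_inner_eq g fun V _ ↦ key (V x)

end LeviCivitaSmooth

/-! ### Sasakian geometry: the Reeb field and its curvature -/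

section Sasakian

variable {E : Type*} [NormedAddCommGroup E] [NormedSpace ℝ E]
  {H : Type*} [TopologicalSpace H] {I : ModelWithCorners ℝ E H}
  {M : Type*} [TopologicalSpace M] [ChartedSpace H M] [IsManifold I ∞ M]
  {X Y : ∀ x : M, TangentSpace I x} {x : M} {g : SmoothMetric I M}

namespace SasakianStructure

variable (S : SasakianStructure g)

/-- From `φ² ξ = 0`, the formula for `φ²` applied to `φ ξ` gives `φ ξ = c ξ` with `c = η(φ ξ)`; then
`c φ ξ = φ² ξ = 0`. -/
theorem phi_xi (x : M) : S.phi x (S.xi x) = 0 := by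
  have h1 : S.phi x (S.phi x (S.xi x)) = 0 := by
    rw [S.phi_phi, S.eta_xi, one_smul, neg_add_cancel]
  have h2 := S.phi_phi x (S.phi x (S.xi x))
  rw [h1, map_zero] at h2
  have h3 : S.phi x (S.xi x) = S.eta x (S.phi x (S.xi x)) • S.xi x := by
    rw [← sub_eq_zero, ← neg_eq_zero, neg_sub, sub_eq_neg_add, ← h2]
  have h4 : S.eta x (S.phi x (S.xi x)) • S.phi x (S.xi x) = 0 := by
    rw [← map_smul, ← h3, h1]
  rcases smul_eq_zero.1 h4 with h | h
  · rw [h3, h, zero_smul]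
  · exact h

theorem xi_ne_zero (x : M) : S.xi x ≠ 0 := by
  intro h
  have := S.eta_xi x
  rw [h, map_zero] at this
  exact zero_ne_one this

/-- Compute `φ³ v` both as `φ²(φ v)` and as `φ(φ² v)`; the difference is `η(φ v) ξ`. -/
theorem eta_phi (x : M) (v : TangentSpace I x) : S.eta x (S.phi x v) = 0 := by
  have h1 := S.phi_phi x (S.phi x v)
  rw [S.phi_phi x v, map_add, map_neg, map_smul, S.phi_xi, smul_zero, add_zero] at h1
  have h2 : S.eta x (S.phi x v) • S.xi x = 0 := by simpa using h1
  exact (smul_eq_zero.1 h2).resolve_right (S.xi_ne_zero x)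

theorem inner_xi (x : M) (v : TangentSpace I x) : g.inner x v (S.xi x) = S.eta x v := by
  have h := S.compatible x v (S.xi x)
  rw [S.phi_xi, map_zero, S.eta_xi, mul_one] at h
  linarith

theorem inner_phi_left (x : M) (v w : TangentSpace I x) :
    g.inner x (S.phi x v) w = - g.inner x v (S.phi x w) := by
  have h := S.compatible x v (S.phi x w)
  rw [S.eta_phi, mul_zero, sub_zero, S.phi_phi, map_add, map_neg, map_smul, S.inner_xi,
    S.eta_phi, smul_zero, add_zero] at h
  linarith

theorem smoothAt_xi (x : M) : SmoothAt S.xi x := S.xi_smooth.contMDiffAt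

theorem smoothAt_phi (hX : SmoothAt X x) : SmoothAt (fun y ↦ S.phi y (X y)) x :=
  ContMDiffAt.clm_bundle_apply (F₁ := E) (F₂ := E) S.phi_smooth.contMDiffAt hX

theorem extDeriv_eta (hX : MDiffAt (T% X) x) (hY : MDiffAt (T% Y) x) :
    extDeriv S.eta X Y x = 2 * g.inner x (X x) (S.phi x (Y x)) := by
  have := S.contact X Y x hX hY
  linarith

theorem mdiffAt_phi (hX : MDiffAt (T% X) x) : MDiffAt (T% (fun y ↦ S.phi y (X y))) x :=
  MDifferentiableAt.clm_bundle_apply (F₁ := E) (F₂ := E)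
    (S.phi_smooth.contMDiffAt.mdifferentiableAt (by simp)) hX

theorem contMDiffAt_eta (hX : SmoothAt X x) :
    ContMDiffAt I 𝓘(ℝ) ∞ (fun y ↦ S.eta y (X y)) x := by
  simpa only [S.inner_xi] using hX.inner g (S.smoothAt_xi x)

theorem extDeriv_xi (hX : MDiffAt (T% X) x) : extDeriv S.eta S.xi X x = 0 := by
  have h := S.contact S.xi X x (S.smoothAt_xi x).mdiffAt hX
  rw [g.symm, S.inner_xi, S.eta_phi] at h
  linarith

/-- The contact form is invariant under the Reeb flow. -/
theorem mvfderiv_eta_xi (hX : MDiffAt (T% X) x) :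
    mvfderiv I (fun y ↦ S.eta y (X y)) x (S.xi x) = S.eta x (mlieBracket I S.xi X x) := by
  have h := S.extDeriv_xi hX
  have e : (fun y ↦ S.eta y (S.xi y)) = fun _ ↦ (1 : ℝ) := funext S.eta_xi
  simp only [extDeriv, e, mvfderiv_const, zero_apply, sub_zero] at h
  linarith

/-- The structure tensor is invariant under the Reeb flow. -/
theorem mlieBracket_xi_phi (hX : SmoothAt X x) :
    mlieBracket I S.xi (fun y ↦ S.phi y (X y)) x = S.phi x (mlieBracket I S.xi X x) := by
  -- Since `φ ξ = 0` and `dη(ξ, ·) = 0`, normality reduces to `φ(φ [ξ, X] - [ξ, φ X]) = 0`. Both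
  -- terms in the parenthesis lie in `ker η`, where `φ² = -1`, so they agree.
  have hn := S.normal S.xi X x (S.smoothAt_xi x).mdiffAt hX.mdiffAt
  have e : (fun y ↦ S.phi y (S.xi y)) = 0 := funext S.phi_xi
  rw [S.extDeriv_xi hX.mdiffAt, zero_smul, add_zero] at hn
  simp only [nijenhuis, e, mlieBracket_zero_left, Pi.zero_apply, map_zero, add_zero,
    sub_zero] at hn
  have h0 : S.eta x (mlieBracket I S.xi (fun y ↦ S.phi y (X y)) x) = 0 := by
    rw [← S.mvfderiv_eta_xi (S.smoothAt_phi hX).mdiffAt]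
    simp only [S.eta_phi, mvfderiv_const, zero_apply]
  rw [← map_sub] at hn
  have h1 := S.phi_phi x (S.phi x (mlieBracket I S.xi X x)
    - mlieBracket I S.xi (fun y ↦ S.phi y (X y)) x)
  rw [hn, map_zero, map_sub, h0, S.eta_phi, sub_zero, zero_smul, add_zero, eq_comm,
    neg_eq_zero, sub_eq_zero] at h1
  exact h1.symm

variable [FiniteDimensional ℝ E]

theorem inner_leviCivita_xi_xi (x : M) (v : TangentSpace I x) :
    g.inner x (leviCivita g S.xi x v) (S.xi x) = 0 := by
  have hξ := (S.smoothAt_xi x).mdiffAt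
  have hV := (smoothAt_extend (I := I) v).mdiffAt
  have hv : FiberBundle.extend E v x = v := FiberBundle.extend_apply_self E v
  have h := leviCivita_metric g hV hξ hξ
  have e : (fun y ↦ g.inner y (S.xi y) (S.xi y)) = fun _ ↦ (1 : ℝ) :=
    funext fun y ↦ by rw [S.inner_xi, S.eta_xi]
  rw [e, mvfderiv_const, zero_apply, g.symm x (S.xi x), hv] at h
  linarith

/-- Write `η = g(·, ξ)` and use metric compatibility and vanishing torsion: the derivatives of `X`
and `Y` cancel against the bracket. -/
theorem extDeriv_eq_inner_leviCivita (hX : MDiffAt (T% X) x) (hY : MDiffAt (T% Y) x) :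
    extDeriv S.eta X Y x =
      g.inner x (leviCivita g S.xi x (X x)) (Y x) - g.inner x (leviCivita g S.xi x (Y x)) (X x) := by
  have hξ := (S.smoothAt_xi x).mdiffAt
  simp only [extDeriv, ← S.inner_xi]
  rw [leviCivita_metric g hX hY hξ, leviCivita_metric g hY hX hξ, ← leviCivita_torsion g hX hY,
    map_sub, sub_apply, g.symm x (X x), g.symm x (Y x) (leviCivita g S.xi x (X x))]
  ring

/-- The integral curves of the Reeb field are geodesics. -/
theorem leviCivita_xi_xi (x : M) : leviCivita g S.xi x (S.xi x) = 0 := by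
  refine eq_of_inner_eq g fun Z hZ ↦ ?_
  have h := S.extDeriv_eq_inner_leviCivita (S.smoothAt_xi x).mdiffAt hZ
  rw [S.extDeriv_xi hZ, S.inner_leviCivita_xi_xi, sub_zero] at h
  rw [← h, map_zero, zero_apply]

/-- The expression is `R(X, Y) ξ` once `∇ξ = -φ` is known. The terms `(X f) φ Y` coming from the
first and the last summand cancel. This is what later allows an arbitrary extension of `ξ x` in the
middle slot to be replaced by `ξ`. -/
theorem tensorialAt_curvatureField_xi :
    TensorialAt I E (fun Y ↦ - leviCivita g (fun y ↦ S.phi y (Y y)) x (X x)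
      + leviCivita g (fun y ↦ S.phi y (X y)) x (Y x) + S.phi x (mlieBracket I X Y x)) x := by
  have : CompleteSpace E := FiniteDimensional.complete ℝ E
  constructor
  · intro f Y hf hY
    have e : (fun y ↦ S.phi y ((f • Y) y)) = f • fun y ↦ S.phi y (Y y) := by
      ext1 y; simp
    rw [e, (leviCivita g).isCovariantDerivativeOnUniv.leibniz (S.mdiffAt_phi hY) hf,
      mlieBracket_smul_right hf hY]
    simp
    abel
  · intro Y Y' hY hY'
    have e : (fun y ↦ S.phi y ((Y + Y') y))
        = (fun y ↦ S.phi y (Y y)) + fun y ↦ S.phi y (Y' y) := by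
      ext1 y; simp
    rw [e, (leviCivita g).isCovariantDerivativeOnUniv.add (S.mdiffAt_phi hY) (S.mdiffAt_phi hY'),
      mlieBracket_add_right hY hY']
    simp
    abel

variable [Nontrivial E]

/-- The form `dη` is invariant under the Reeb flow. -/
theorem mvfderiv_xi_inner_phi (hX : SmoothAt X x) (hY : SmoothAt Y x) :
    mvfderiv I (fun y ↦ g.inner y (X y) (S.phi y (Y y))) x (S.xi x) =
      g.inner x (mlieBracket I S.xi X x) (S.phi x (Y x))
        + g.inner x (X x) (S.phi x (mlieBracket I S.xi Y x)) := by
  have hξ := S.smoothAt_xi x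
  have hξX := hξ.mlieBracket hX
  have hξY := hξ.mlieBracket hY
  -- This is `L_ξ dη = d L_ξ η = 0` done by hand: `dη` is expanded and differentiated along `ξ`,
  -- which is then commuted past `X` and `Y`; the Jacobi identity handles `[ξ, [X, Y]]`.
  have e : (fun y ↦ 2 * g.inner y (X y) (S.phi y (Y y))) =ᶠ[𝓝 x] fun y ↦
      mvfderiv I (fun y ↦ S.eta y (Y y)) y (X y) - mvfderiv I (fun y ↦ S.eta y (X y)) y (Y y)
        - S.eta y (mlieBracket I X Y y) := by
    filter_upwards [hX.eventually_mdiffAt, hY.eventually_mdiffAt] with y h1 h2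
    rw [← S.extDeriv_eta h1 h2]; rfl
  have hηX := S.contMDiffAt_eta hX
  have hηY := S.contMDiffAt_eta hY
  have d1 : MDiffAt (fun y ↦ mvfderiv I (fun y ↦ S.eta y (Y y)) y (X y)) x :=
    (contMDiffAt_mvfderiv g hηY hX).mdifferentiableAt (by simp)
  have d2 : MDiffAt (fun y ↦ mvfderiv I (fun y ↦ S.eta y (X y)) y (Y y)) x :=
    (contMDiffAt_mvfderiv g hηX hY).mdifferentiableAt (by simp)
  have d3 : MDiffAt (fun y ↦ S.eta y (mlieBracket I X Y y)) x :=
    (S.contMDiffAt_eta (hX.mlieBracket hY)).mdifferentiableAt (by simp)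
  have d0 : MDiffAt (fun y ↦ g.inner y (X y) (S.phi y (Y y))) x :=
    mdifferentiableAt_inner g hX.mdiffAt (S.smoothAt_phi hY).mdiffAt
  have h := congrArg (fun A ↦ A (S.xi x)) (mvfderiv_congr e)
  have d12 : MDiffAt (fun y ↦ mvfderiv I (fun y ↦ S.eta y (Y y)) y (X y)
      - mvfderiv I (fun y ↦ S.eta y (X y)) y (Y y)) x := d1.sub d2
  rw [mvfderiv_fun_sub d12 d3, mvfderiv_fun_sub d1 d2,
    mvfderiv_fun_mul mdifferentiableAt_const d0] at h
  simp only [sub_apply, smul_apply, mvfderiv_const, smul_zero, add_zero,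
    smul_eq_mul] at h
  rw [S.mvfderiv_eta_xi (hX.mlieBracket hY).mdiffAt] at h
  have b1 := mvfderiv_mlieBracket g hηY hξ hX
  have b2 := mvfderiv_mlieBracket g hηX hξ hY
  have c : ∀ {A : ∀ y : M, TangentSpace I y}, SmoothAt A x →
      mvfderiv I (fun y ↦ mvfderiv I (fun y ↦ S.eta y (A y)) y (S.xi y)) x =
      mvfderiv I (fun y ↦ S.eta y (mlieBracket I S.xi A y)) x := by
    intro A hA
    refine mvfderiv_congr ?_
    filter_upwards [hA.eventually_mdiffAt] with y hy using S.mvfderiv_eta_xi hy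
  rw [c hY] at b1
  rw [c hX] at b2
  have e1 := S.extDeriv_eta hξX.mdiffAt hY.mdiffAt
  have e2 := S.extDeriv_eta hX.mdiffAt hξY.mdiffAt
  rw [extDeriv] at e1 e2
  have j := congrArg (S.eta x) (mlieBracket_leibniz hξ hX hY)
  rw [map_add] at j
  linarith

/-- The Reeb field is a Killing field. -/
theorem inner_leviCivita_xi_skew (x : M) (v w : TangentSpace I x) :
    g.inner x (leviCivita g S.xi x v) w = - g.inner x v (leviCivita g S.xi x w) := by
  -- Invariance of `dη` and of `φ` gives the Killing equation when the second argument has the form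
  -- `φ w`. Replacing `w` by `φ w` and using `φ² = -1 + η ⊗ ξ` covers every argument, as the
  -- `ξ`-component contributes zero on both sides.
  have key : ∀ v w : TangentSpace I x, g.inner x (leviCivita g S.xi x v) (S.phi x w)
      = - g.inner x v (leviCivita g S.xi x (S.phi x w)) := by
    intro v w
    have hX := smoothAt_extend (I := I) v
    have hY := smoothAt_extend (I := I) w
    have hv : FiberBundle.extend E v x = v := FiberBundle.extend_apply_self E v
    have hw : FiberBundle.extend E w x = w := FiberBundle.extend_apply_self E w
    generalize FiberBundle.extend E v = X at hX hv
    generalize FiberBundle.extend E w = Y at hY hw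
    subst hv hw
    have hξ := (S.smoothAt_xi x).mdiffAt
    have hφY := (S.smoothAt_phi hY).mdiffAt
    have h := S.mvfderiv_xi_inner_phi hX hY
    rw [leviCivita_metric g hξ hX.mdiffAt hφY, ← S.mlieBracket_xi_phi hY,
      ← leviCivita_torsion g hξ hX.mdiffAt, ← leviCivita_torsion g hξ hφY] at h
    simp only [map_sub, sub_apply] at h
    linarith
  have h1 := key v (S.phi x w)
  have h2 : g.inner x v (leviCivita g S.xi x (S.phi x (S.phi x w)))
      = - g.inner x v (leviCivita g S.xi x w) := by
    rw [S.phi_phi, map_add, map_smul, S.leviCivita_xi_xi, smul_zero, add_zero, map_neg, map_neg]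
  rw [h2, S.phi_phi, map_add, map_neg, map_smul, S.inner_leviCivita_xi_xi, smul_zero,
    add_zero] at h1
  linarith

/-- The covariant derivative of the Reeb field is `-φ`. -/
theorem leviCivita_xi (x : M) (v : TangentSpace I x) : leviCivita g S.xi x v = - S.phi x v := by
  refine eq_of_inner_eq g fun Y hY ↦ ?_
  have hX := smoothAt_extend (I := I) v
  have hv : FiberBundle.extend E v x = v := FiberBundle.extend_apply_self E v
  -- For a Killing field the two terms of `dη` coincide, so `2 g(∇_X ξ, Y) = dη(X, Y) = 2 g(X, φ
  -- Y)`.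
  have h1 := S.extDeriv_eq_inner_leviCivita hX.mdiffAt hY
  rw [S.extDeriv_eta hX.mdiffAt hY, hv, S.inner_leviCivita_xi_skew x (Y x), g.symm x (Y x)] at h1
  rw [map_neg, neg_apply, S.inner_phi_left]
  linarith

/-- Here `∇_ξ φ = 0` follows from `L_ξ φ = 0`, because the difference of the two derivatives is the
commutator of `φ` with `∇ξ = -φ`. -/
theorem leviCivita_phi (hX : SmoothAt X x) :
    leviCivita g (fun y ↦ S.phi y (X y)) x (S.xi x) = S.phi x (leviCivita g X x (S.xi x)) := by
  have h1 := leviCivita_torsion g (S.smoothAt_xi x).mdiffAt (S.smoothAt_phi hX).mdiffAt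
  have h2 := leviCivita_torsion g (S.smoothAt_xi x).mdiffAt hX.mdiffAt
  rw [S.mlieBracket_xi_phi hX, ← h2, S.leviCivita_xi, S.leviCivita_xi, map_sub, map_neg,
    sub_left_inj] at h1
  exact h1

theorem leviCivita_leviCivita_xi (hX : SmoothAt X x) (v : TangentSpace I x) :
    leviCivita g (fun y ↦ leviCivita g S.xi y (X y)) x v
      = - leviCivita g (fun y ↦ S.phi y (X y)) x v := by
  have e : (fun y ↦ leviCivita g S.xi y (X y)) = (-1 : ℝ) • fun y ↦ S.phi y (X y) := by
    ext1 y
    rw [S.leviCivita_xi]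
    simp
  rw [e, (leviCivita g).isCovariantDerivativeOnUniv.smul_const _ (S.smoothAt_phi hX).mdiffAt]
  simp

/-- The curvature operator `R(·, ξ) ξ` is the orthogonal projection onto the contact
distribution. -/
theorem curvatureField_xi (hX : SmoothAt X x) :
    curvatureField g X S.xi S.xi x = X x - S.eta x (X x) • S.xi x := by
  have h := leviCivita_torsion g hX.mdiffAt (S.smoothAt_xi x).mdiffAt
  have e : (fun y ↦ leviCivita g S.xi y (S.xi y)) = 0 := funext S.leviCivita_xi_xi
  -- With `∇_ξ ξ = 0`, what remains is `∇_ξ(φ X) + φ [X, ξ]`; the terms `φ ∇_ξ X` cancel and leave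
  -- `-φ² X`.
  rw [curvatureField, ← h, S.leviCivita_leviCivita_xi hX, e, (leviCivita g).zero, S.leviCivita_phi hX]
  simp only [S.leviCivita_xi, map_sub, map_neg, S.phi_phi]
  simp
  abel

/-- `curvature` differentiates chosen extensions of `ξ x`, not `ξ` itself. The last slot is switched
to `ξ` by `curvatureField_congr_right`, the middle one by `tensorialAt_curvatureField_xi`. -/
theorem curvature_xi (x : M) (v : TangentSpace I x) :
    curvature g x v (S.xi x) (S.xi x) = v - S.eta x v • S.xi x := by
  have hX := smoothAt_extend (I := I) v
  have hv : FiberBundle.extend E v x = v := FiberBundle.extend_apply_self E v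
  have hY := smoothAt_extend (I := I) (S.xi x)
  have hy : FiberBundle.extend E (S.xi x) x = S.xi x := FiberBundle.extend_apply_self E _
  have h0 : curvature g x v (S.xi x) (S.xi x) = curvatureField g (FiberBundle.extend E v)
      (FiberBundle.extend E (S.xi x)) (FiberBundle.extend E (S.xi x)) x := by
    simp only [curvature, curvatureField, hv, hy]
  have hT : ∀ {Y : ∀ y : M, TangentSpace I y}, SmoothAt Y x →
      curvatureField g (FiberBundle.extend E v) Y S.xi x =
      - leviCivita g (fun y ↦ S.phi y (Y y)) x (FiberBundle.extend E v x)
      + leviCivita g (fun y ↦ S.phi y (FiberBundle.extend E v y)) x (Y x)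
      + S.phi x (mlieBracket I (FiberBundle.extend E v) Y x) := by
    intro Y hY
    rw [curvatureField, S.leviCivita_leviCivita_xi hX, S.leviCivita_leviCivita_xi hY,
      S.leviCivita_xi, sub_neg_eq_add, sub_neg_eq_add]
  rw [h0, curvatureField_congr_right g hX hY hY (S.smoothAt_xi x) hy, hT hY,
    S.tensorialAt_curvatureField_xi.pointwise hY.mdiffAt (S.smoothAt_xi x).mdiffAt hy,
    ← hT (S.smoothAt_xi x), S.curvatureField_xi hX, hv]

end SasakianStructure

end Sasakian

/-! ### Covariant derivative along a curve -/

section AlongCurves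

variable {E : Type*} [NormedAddCommGroup E] [NormedSpace ℝ E]
  {H : Type*} [TopologicalSpace H] {I : ModelWithCorners ℝ E H}
  {M : Type*} [TopologicalSpace M] [ChartedSpace H M] [IsManifold I ∞ M]

/-- The vector field `Y` read in the trivialization of the tangent bundle at `p`. -/
def inTrivialization (p : M) (Y : ∀ x : M, TangentSpace I x) (y : M) : E :=
  (trivializationAt E (fun x : M ↦ TangentSpace I x) p ⟨y, Y y⟩).2

theorem mdifferentiableAt_inTrivialization {p : M} {Y : ∀ x : M, TangentSpace I x}
    (hY : MDiffAt (T% Y) p) : MDiffAt (inTrivialization p Y) p :=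
  ((mdifferentiableAt_totalSpace _ _).1 hY).2

/-- The extensions used by `covDerivAlong` are constant in the trivialization, so their flat
derivative vanishes and `∇` of them is the pure Christoffel term. -/
theorem inTrivialization_extend_eventuallyEq (p : M) (v : TangentSpace I p) :
    inTrivialization p (FiberBundle.extend E v : ∀ x : M, TangentSpace I x) =ᶠ[𝓝 p]
      fun _ ↦ (trivializationAt E (fun x : M ↦ TangentSpace I x) p ⟨p, v⟩).2 := by
  let t := trivializationAt E (fun x : M ↦ TangentSpace I x) p
  filter_upwards [t.open_baseSet.mem_nhds (FiberBundle.mem_baseSet_trivializationAt' p)] with y hy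
  simp only [inTrivialization, FiberBundle.extend]
  rw [t.apply_mk_symm hy]

theorem inTrivialization_smul {p y : M}
    (hy : y ∈ (trivializationAt E (fun x : M ↦ TangentSpace I x) p).baseSet) (f : M → ℝ)
    (Y : ∀ x : M, TangentSpace I x) :
    inTrivialization p (f • Y) y = f y • inTrivialization p Y y := by
  simp only [inTrivialization]
  rw [← Trivialization.continuousLinearMapAt_apply_of_mem (R := ℝ) _ hy,
    ← Trivialization.continuousLinearMapAt_apply_of_mem (R := ℝ) _ hy]
  exact map_smul _ _ _

theorem inTrivialization_add {p y : M}
    (hy : y ∈ (trivializationAt E (fun x : M ↦ TangentSpace I x) p).baseSet)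
    (Y Y' : ∀ x : M, TangentSpace I x) :
    inTrivialization p (Y + Y') y = inTrivialization p Y y + inTrivialization p Y' y := by
  simp only [inTrivialization]
  rw [← Trivialization.continuousLinearMapAt_apply_of_mem (R := ℝ) _ hy,
    ← Trivialization.continuousLinearMapAt_apply_of_mem (R := ℝ) _ hy,
    ← Trivialization.continuousLinearMapAt_apply_of_mem (R := ℝ) _ hy]
  exact map_add _ _ _

theorem symmL_inTrivialization (p : M) (Y : ∀ x : M, TangentSpace I x) :
    (trivializationAt E (fun x : M ↦ TangentSpace I x) p).symmL ℝ p (inTrivialization p Y p)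
      = Y p := by
  have hp := FiberBundle.mem_baseSet_trivializationAt' (F := E)
    (E := fun x : M ↦ TangentSpace I x) p
  rw [inTrivialization, ← Trivialization.continuousLinearMapAt_apply_of_mem (R := ℝ) _ hp,
    Trivialization.symmL_continuousLinearMapAt _ hp]

variable [FiniteDimensional ℝ E] (g : SmoothMetric I M)

/-- The difference of the Levi-Civita connection and the flat connection of the trivialization at
`p` is tensorial. -/
theorem tensorialAt_leviCivita_sub (p : M) (v : TangentSpace I p) :
    TensorialAt I E (fun Y ↦ leviCivita g Y p v
      - (trivializationAt E (fun x : M ↦ TangentSpace I x) p).symmL ℝ p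
        (mvfderiv I (inTrivialization p Y) p v)) p := by
  have hp := (trivializationAt E (fun x : M ↦ TangentSpace I x) p).open_baseSet.mem_nhds
    (FiberBundle.mem_baseSet_trivializationAt' p)
  constructor
  · intro f Y hf hY
    have e : inTrivialization p (f • Y) =ᶠ[𝓝 p] f • inTrivialization p Y :=
      Filter.eventually_of_mem hp fun y hy ↦ inTrivialization_smul hy f Y
    rw [mvfderiv_congr e, mvfderiv_smul hf (mdifferentiableAt_inTrivialization hY),
      (leviCivita g).isCovariantDerivativeOnUniv.leibniz hY hf]
    simp [symmL_inTrivialization, smul_sub]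
  · intro Y Y' hY hY'
    have e : inTrivialization p (Y + Y') =ᶠ[𝓝 p] inTrivialization p Y + inTrivialization p Y' :=
      Filter.eventually_of_mem hp fun y hy ↦ inTrivialization_add hy Y Y'
    rw [mvfderiv_congr e, mvfderiv_add (mdifferentiableAt_inTrivialization hY)
      (mdifferentiableAt_inTrivialization hY'),
      (leviCivita g).isCovariantDerivativeOnUniv.add hY hY']
    simp
    abel

/-- The covariant derivative along a curve of a combination of vector fields. -/
theorem covDerivAlong_sum {ι : Type*} [Fintype ι] {γ : ℝ → M} {t : ℝ} {w : ι → ℝ → ℝ} {w' : ι → ℝ}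
    {Y : ι → ∀ x : M, TangentSpace I x} (hγ : MDifferentiableAt 𝓘(ℝ, ℝ) I γ t)
    (hw : ∀ i, HasDerivAt (w i) (w' i) t) (hY : ∀ i, MDiffAt (T% (Y i)) (γ t)) :
    covDerivAlong g γ (fun s ↦ ∑ i, w i s • Y i (γ s)) t =
      ∑ i, (w' i • Y i (γ t) + w i t • leviCivita g (Y i) (γ t) (velocity I γ t)) := by
  let p := γ t
  let T := trivializationAt E (fun x : M ↦ TangentSpace I x) p
  have hpT : p ∈ T.baseSet := FiberBundle.mem_baseSet_trivializationAt' p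
  let v := velocity I γ t
  -- `Φ` is the Christoffel term at `p` in direction `v`. Expressed through any field `Y i`, it is
  -- `∇_v (Y i)` minus the flat derivative, and the latter cancels against the derivative of the
  -- coordinates along `γ`.
  let Φ := TensorialAt.mkHom _ p (tensorialAt_leviCivita_sub g p v)
  have hΦ : ∀ {Y : ∀ x : M, TangentSpace I x}, MDiffAt (T% Y) p →
      Φ (Y p) = leviCivita g Y p v - T.symmL ℝ p (mvfderiv I (inTrivialization p Y) p v) :=
    fun hY ↦ TensorialAt.mkHom_apply (tensorialAt_leviCivita_sub g p v) hY
  have hext : ∀ u : TangentSpace I p, leviCivita g (FiberBundle.extend E u) p v = Φ u := by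
    intro u
    have h := hΦ (FiberBundle.mdifferentiableAt_extend I E u)
    rw [FiberBundle.extend_apply_self, mvfderiv_congr (inTrivialization_extend_eventuallyEq p u),
      mvfderiv_const] at h
    simpa using h.symm
  have hderiv : HasDerivAt (fun s ↦ (T ⟨γ s, ∑ i, w i s • Y i (γ s)⟩).2)
      (∑ i, (w' i • inTrivialization p (Y i) p
        + w i t • mvfderiv I (inTrivialization p (Y i)) p v)) t := by
    have h1 : HasDerivAt (fun s ↦ ∑ i, w i s • inTrivialization p (Y i) (γ s))
        (∑ i, (w' i • inTrivialization p (Y i) p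
          + w i t • mvfderiv I (inTrivialization p (Y i)) p v)) t := by
      refine HasDerivAt.fun_sum fun i _ ↦ ?_
      have h2 : HasDerivAt (fun s ↦ inTrivialization p (Y i) (γ s))
          (mvfderiv I (inTrivialization p (Y i)) p v) t := by
        have h3 : HasFDerivAt (inTrivialization p (Y i) ∘ γ)
            ((mvfderiv I (inTrivialization p (Y i)) p : E →L[ℝ] E).comp
              (mfderiv 𝓘(ℝ, ℝ) I γ t : ℝ →L[ℝ] E)) t :=
          ((mdifferentiableAt_inTrivialization (hY i)).hasMFDerivAt.comp t
            hγ.hasMFDerivAt).hasFDerivAt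
        exact h3.hasDerivAt
      rw [add_comm]
      exact (hw i).smul h2
    refine h1.congr_of_eventuallyEq ?_
    filter_upwards [hγ.continuousAt.preimage_mem_nhds (T.open_baseSet.mem_nhds hpT)] with s hs
    have hs' : γ s ∈ T.baseSet := hs
    rw [← Trivialization.continuousLinearMapAt_apply_of_mem (R := ℝ) T hs', map_sum]
    refine Finset.sum_congr rfl fun i _ ↦ ?_
    rw [map_smul, Trivialization.continuousLinearMapAt_apply_of_mem (R := ℝ) T hs']
    rfl
  have hsymm : ∀ u : E, T.symm p u = T.symmL ℝ p u := fun u ↦ (T.symmL_apply hpT u).symm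
  change T.symm p (deriv (fun s ↦ (T ⟨γ s, ∑ i, w i s • Y i (γ s)⟩).2) t)
    + leviCivita g (FiberBundle.extend E (∑ i, w i t • Y i p)) p v = _
  rw [hderiv.deriv, hext, hsymm, map_sum, map_sum, ← Finset.sum_add_distrib]
  refine Finset.sum_congr rfl fun i _ ↦ ?_
  rw [map_add, map_smul, map_smul, map_smul, hΦ (hY i), symmL_inTrivialization, smul_sub]
  abel

end AlongCurves

/-! ### Completeness and regularity of integral curves -/

section IntegralCurves

open Set

variable {E : Type*} [NormedAddCommGroup E] [NormedSpace ℝ E] [CompleteSpace E]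
  {H : Type*} [TopologicalSpace H] {I : ModelWithCorners ℝ E H}
  {M : Type*} [TopologicalSpace M] [ChartedSpace H M]
  {v : ∀ x : M, TangentSpace I x} {x₀ : M}

section

variable [IsManifold I 1 M]

/-- Integral curves through the points of a neighbourhood exist for a common time. -/
theorem exists_nhds_forall_isMIntegralCurveOn
    (hv : CMDiffAt 1 (fun x ↦ (⟨x, v x⟩ : TangentBundle I M)) x₀) (hx : I.IsInteriorPoint x₀) :
    ∃ U ∈ 𝓝 x₀, ∃ ε > (0 : ℝ), ∀ x ∈ U, ∃ γ : ℝ → M, γ 0 = x ∧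
      IsMIntegralCurveOn γ v (Ioo (-ε) ε) := by
  rw [contMDiffAt_iff] at hv
  obtain ⟨_, hv⟩ := hv
  obtain ⟨δ, hδ, a, r, L, K, hr, hpl⟩ := IsPicardLindelof.of_contDiffAt_one
    (hv.contDiffAt (range_mem_nhds_isInteriorPoint hx)).snd
  obtain ⟨α, hα, hcont⟩ :=
    (hpl 0).exists_forall_mem_closedBall_eq_hasDerivWithinAt_continuousOn
  set y₀ := extChartAt I x₀ x₀ with hy₀
  have hnhds : Metric.closedBall y₀ r ×ˢ Icc (0 - δ) (0 + δ) ∈ 𝓝 (y₀, (0 : ℝ)) :=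
    prod_mem_nhds (Metric.closedBall_mem_nhds _ hr) (Icc_mem_nhds (by linarith) (by linarith))
  have hα0 : α (y₀, 0) = y₀ := (hα y₀ (Metric.mem_closedBall_self r.2)).1
  -- Joint continuity of the local flow in initial point and time keeps the solutions inside the
  -- chart on a product neighbourhood; this is the source of the common time `ε`.
  have hmem : α ⁻¹' (interior (extChartAt I x₀).target) ∈ 𝓝 (y₀, (0 : ℝ)) := by
    refine (hcont.continuousAt hnhds).preimage_mem_nhds ?_
    rw [hα0]
    exact isOpen_interior.mem_nhds ((I.isInteriorPoint_iff).mp hx)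
  obtain ⟨V, hV, J, hJ, hVJ⟩ := mem_nhds_prod_iff.1 (Filter.inter_mem hmem hnhds)
  obtain ⟨ε, hε, hεJ⟩ := Metric.mem_nhds_iff.1 (Filter.inter_mem hJ (Ioo_mem_nhds
    (show 0 - δ < (0 : ℝ) by linarith) (show (0 : ℝ) < 0 + δ by linarith)))
  refine ⟨(extChartAt I x₀).source ∩ extChartAt I x₀ ⁻¹' V, Filter.inter_mem
    (extChartAt_source_mem_nhds x₀) ((continuousAt_extChartAt x₀).preimage_mem_nhds hV), ε, hε, ?_⟩
  rintro x ⟨hxs, hxV⟩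
  have hxr : extChartAt I x₀ x ∈ Metric.closedBall y₀ r :=
    (hVJ (mk_mem_prod hxV (mem_of_mem_nhds hJ))).2.1
  obtain ⟨h0, hd⟩ := hα _ hxr
  set f : ℝ → E := fun t ↦ α (extChartAt I x₀ x, t) with hf
  refine ⟨(extChartAt I x₀).symm ∘ f, ?_, ?_⟩
  · change (extChartAt I x₀).symm (α (extChartAt I x₀ x, 0)) = x
    rw [h0, (extChartAt I x₀).left_inv hxs]
  intro t ht
  have htJ := hεJ (show t ∈ Metric.ball (0 : ℝ) ε by
    rwa [Real.ball_eq_Ioo, zero_sub, zero_add])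
  have hf3 : f t ∈ interior (extChartAt I x₀).target := (hVJ (mk_mem_prod hxV htJ.1)).1
  let xₜ : M := (extChartAt I x₀).symm (f t)
  have h : HasDerivAt f (x := t) <| fderivWithin ℝ (extChartAt I x₀ ∘ (extChartAt I xₜ).symm)
    (range I) (extChartAt I xₜ xₜ) (v xₜ) :=
    (hd t ⟨htJ.2.1.le, htJ.2.2.le⟩).hasDerivAt (Icc_mem_nhds htJ.2.1 htJ.2.2)
  rw [← tangentCoordChange_def] at h
  have hf3' := mem_of_mem_of_subset hf3 interior_subset
  have hft1 := mem_preimage.mp <|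
    mem_of_mem_of_subset hf3' (extChartAt I x₀).target_subset_preimage_source
  have hft2 := mem_extChartAt_source (I := I) xₜ
  -- The equation is solved in the chart at `x₀`, but the velocity at time `t` is read in the chart
  -- at `xₜ`; the two coordinate changes cancel.
  have hv : tangentCoordChange I x₀ xₜ xₜ (tangentCoordChange I xₜ x₀ xₜ (v xₜ)) = v xₜ :=
    (tangentCoordChange_comp (E := E) (v := v xₜ) ⟨⟨hft2, hft1⟩, hft2⟩).trans
      (tangentCoordChange_self (E := E) hft2)
  have hd2 : HasFDerivAt (extChartAt I xₜ ∘ (extChartAt I x₀).symm)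
      (tangentCoordChange I x₀ xₜ xₜ) (f t) := by
    have h1 := hasFDerivWithinAt_tangentCoordChange (I := I) (x := x₀) (y := xₜ) (z := xₜ)
      ⟨hft1, hft2⟩
    rw [show extChartAt I x₀ xₜ = f t from (extChartAt I x₀).right_inv hf3'] at h1
    exact h1.hasFDerivAt (mem_nhds_iff.mpr ⟨interior (extChartAt I x₀).target,
      subset_trans interior_subset (extChartAt_target_subset_range ..), isOpen_interior, hf3⟩)
  have hd3 : HasDerivAt ((extChartAt I xₜ ∘ (extChartAt I x₀).symm) ∘ f) (v xₜ) t := by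
    rw [← hv]
    exact hd2.comp_hasDerivAt t h
  have hd4 : HasFDerivAt ((extChartAt I xₜ ∘ (extChartAt I x₀).symm) ∘ f)
      ((1 : ℝ →L[ℝ] ℝ).smulRight (v xₜ : E)) t := by
    convert! hd3.hasFDerivAt using 1
  apply HasMFDerivAt.hasMFDerivWithinAt
  refine ⟨(continuousAt_extChartAt_symm'' hf3').comp h.continuousAt, ?_⟩
  have hd5 := hd4.hasFDerivWithinAt (s := univ)
  simpa only [writtenInExtChartAt, extChartAt_model_space_eq_id, mfld_simps] using! hd5

/-- A `C^1` vector field on a compact manifold without boundary is complete. -/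
theorem exists_isMIntegralCurve_of_compactSpace [CompactSpace M] [T2Space M]
    [BoundarylessManifold I M] (hv : CMDiff 1 (fun x ↦ (⟨x, v x⟩ : TangentBundle I M))) (x₀ : M) :
    ∃ γ : ℝ → M, γ 0 = x₀ ∧ IsMIntegralCurve γ v := by
  choose U hU ε hε h using fun x ↦ exists_nhds_forall_isMIntegralCurveOn (hv.contMDiffAt (x := x))
    BoundarylessManifold.isInteriorPoint
  obtain ⟨s, hs⟩ := CompactSpace.elim_nhds_subcover U hU
  have hne : s.Nonempty := by
    by_contra hs'
    rw [Finset.not_nonempty_iff_eq_empty] at hs'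
    subst hs'
    simpa using hs.ge (mem_univ x₀)
  -- The minimum over a finite cover is an existence time valid at every point, and a uniform time
  -- lets curves be prolonged forever.
  refine exists_isMIntegralCurve_of_isMIntegralCurveOn hv (ε := s.inf' hne ε)
    ((Finset.lt_inf'_iff hne).2 fun x _ ↦ hε x) (fun x ↦ ?_) x₀
  obtain ⟨y, hy, hxy⟩ := mem_iUnion₂.1 (hs.ge (mem_univ x))
  obtain ⟨γ, h0, hγ⟩ := h y x hxy
  have hle : s.inf' hne ε ≤ ε y := Finset.inf'_le ε hy
  exact ⟨γ, h0, hγ.mono (Ioo_subset_Ioo (neg_le_neg hle) hle)⟩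

end

/-- Integral curves of smooth vector fields are `C^2`. -/
theorem contMDiff_two_of_isMIntegralCurve [IsManifold I ∞ M] [BoundarylessManifold I M]
    (hv : CMDiff 2 (fun x ↦ (⟨x, v x⟩ : TangentBundle I M))) {γ : ℝ → M}
    (hγ : IsMIntegralCurve γ v) : ContMDiff 𝓘(ℝ, ℝ) I 2 γ := by
  intro t₀
  -- `F` is `v` read in the chart at `γ t₀`. There `γ` solves `u' = F u` with `F` of class `C^2`, so
  -- it inherits that regularity.
  set F : E → E := fun x ↦
    tangentCoordChange I ((extChartAt I (γ t₀)).symm x) (γ t₀) ((extChartAt I (γ t₀)).symm x)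
      (v ((extChartAt I (γ t₀)).symm x)) with hF
  have h0 := hv.contMDiffAt (x := γ t₀)
  rw [contMDiffAt_iff] at h0
  have h1 : ContDiffAt ℝ 2 F (extChartAt I (γ t₀) (γ t₀)) :=
    (h0.2.contDiffAt (range_mem_nhds_isInteriorPoint BoundarylessManifold.isInteriorPoint)).snd
  obtain ⟨u, hu, hFu⟩ := h1.contDiffOn (m := 2) le_rfl (by simp)
  have hcont : ContinuousAt (extChartAt I (γ t₀) ∘ γ) t₀ :=
    (continuousAt_extChartAt (γ t₀)).comp hγ.continuous.continuousAt
  have hev : ∀ᶠ t in 𝓝 t₀, HasDerivAt (extChartAt I (γ t₀) ∘ γ)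
      (F ((extChartAt I (γ t₀) ∘ γ) t)) t ∧ (extChartAt I (γ t₀) ∘ γ) t ∈ u := by
    filter_upwards [(hγ.isMIntegralCurveAt t₀).eventually_hasDerivAt,
      hcont.preimage_mem_nhds hu,
      hγ.continuous.continuousAt.preimage_mem_nhds (extChartAt_source_mem_nhds (I := I) (γ t₀))]
      with t h1 h2 h3
    refine ⟨?_, h2⟩
    have h4 : (extChartAt I (γ t₀)).symm (extChartAt I (γ t₀) (γ t)) = γ t :=
      (extChartAt I (γ t₀)).left_inv h3
    have h5 : ∀ y, y = γ t → HasDerivAt (extChartAt I (γ t₀) ∘ γ)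
        (tangentCoordChange I y (γ t₀) y (v y)) t := by
      rintro y rfl
      exact h1
    exact h5 _ h4
  obtain ⟨δ, hδ, hb⟩ := Metric.nhds_basis_closedBall.eventually_iff.1 hev
  rw [Real.closedBall_eq_Icc] at hb
  refine contMDiffAt_iff_target.2 ⟨hγ.continuous.continuousAt, ContDiffAt.contMDiffAt ?_⟩
  have h5 : ContDiffOn ℝ ((2 : ℕ∞) : WithTop ℕ∞) (extChartAt I (γ t₀) ∘ γ)
      (Icc (t₀ - δ) (t₀ + δ)) := by
    refine ODE.contDiffOn_enat_Icc_of_hasDerivWithinAt (f := fun _ ↦ F) (u := u) ?_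
      (fun t ht ↦ (hb ht).1.hasDerivWithinAt) fun t ht ↦ (hb ht).2
    exact ContDiffOn.comp (g := F) (t := u) hFu contDiff_snd.contDiffOn fun p hp ↦ hp.2
  exact h5.contDiffAt (Icc_mem_nhds (by linarith) (by linarith))

end IntegralCurves

/-! ### Global solutions of linear differential equations -/

section LinearODE

open Set

variable {F : Type*} [NormedAddCommGroup F] [NormedSpace ℝ F]

theorem contDiff_two_of_hasDerivAt_linear {A : ℝ → F →L[ℝ] F} (hA : ContDiff ℝ 1 A) {w : ℝ → F}
    (hw : ∀ t, HasDerivAt w (A t (w t)) t) : ContDiff ℝ 2 w := by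
  have hd : deriv w = fun t ↦ A t (w t) := funext fun t ↦ (hw t).deriv
  have hdiff : Differentiable ℝ w := fun t ↦ (hw t).differentiableAt
  have h1 : ContDiff ℝ 1 w := by
    refine contDiff_one_iff_deriv.2 ⟨hdiff, ?_⟩
    rw [hd]
    exact hA.continuous.clm_apply hdiff.continuous
  refine (contDiff_succ_iff_deriv (n := 1)).2 ⟨hdiff, by simp, ?_⟩
  rw [hd]
  exact hA.clm_apply h1

variable [CompleteSpace F]

/-- A linear differential equation with bounded `C^1` coefficients has global solutions. -/
theorem exists_forall_hasDerivAt_linear {A : ℝ → F →L[ℝ] F} (hA : ContDiff ℝ 1 A) {C : ℝ}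
    (hC : ∀ t, ‖A t‖ ≤ C) (w₀ : F) :
    ∃ w : ℝ → F, w 0 = w₀ ∧ ∀ t, HasDerivAt w (A t (w t)) t := by
  have hC0 : 0 ≤ C := (norm_nonneg _).trans (hC 0)
  -- Adding time as a coordinate makes the equation autonomous, so that a uniform local existence
  -- time again suffices.
  let v : ∀ p : ℝ × F, TangentSpace 𝓘(ℝ, ℝ × F) p := fun p ↦ ((1, A p.1 p.2) : ℝ × F)
  have hv : ContMDiff 𝓘(ℝ, ℝ × F) 𝓘(ℝ, ℝ × F).tangent 1
      (fun p ↦ (⟨p, v p⟩ : TangentBundle 𝓘(ℝ, ℝ × F) (ℝ × F))) := by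
    have hv' : ContDiff ℝ 1 (fun p : ℝ × F ↦ ((1, A p.1 p.2) : ℝ × F)) :=
      contDiff_const.prodMk ((hA.comp contDiff_fst).clm_apply contDiff_snd)
    exact contMDiff_vectorSpace_iff_contDiff.2 hv'
  -- On the ball of radius `‖x‖ + 1` about `x` the speed is at most `C (2‖x‖ + 1) ≤ (2C + 1)(‖x‖ +
  -- 1)`. Letting the radius grow with `‖x‖` makes the time independent of `x`.
  let ε : ℝ := 1 / (2 * C + 1)
  have hε : 0 < ε := by positivity
  have hloc : ∀ p : ℝ × F, ∃ γ : ℝ → ℝ × F, γ 0 = p ∧ IsMIntegralCurveOn γ v (Ioo (-ε) ε) := by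
    rintro ⟨s, x⟩
    have hpl : IsPicardLindelof (fun t u ↦ A (s + t) u) (tmin := -ε) (tmax := ε)
        ⟨0, by constructor <;> linarith⟩ x ⟨‖x‖ + 1, by positivity⟩ 0
        ⟨C * (2 * ‖x‖ + 1), by positivity⟩ ⟨C, hC0⟩ := by
      refine ⟨fun t _ ↦ ?_, fun u _ ↦ ?_, fun t _ u hu ↦ ?_, ?_⟩
      · refine ((A (s + t)).lipschitz.weaken ?_).lipschitzOnWith
        exact hC (s + t)
      · exact ((hA.continuous.comp (continuous_const.add continuous_id)).clm_apply
          continuous_const).continuousOn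
      · have hu' : ‖u‖ ≤ 2 * ‖x‖ + 1 := by
          have h1 : ‖u - x‖ ≤ ‖x‖ + 1 := mem_closedBall_iff_norm.1 hu
          have h2 := norm_le_norm_add_norm_sub' u x
          linarith
        exact ((A (s + t)).le_opNorm u).trans
          (mul_le_mul (hC _) hu' (norm_nonneg _) hC0)
      · have h1 : C * (2 * ‖x‖ + 1) * ε ≤ ‖x‖ + 1 := by
          rw [mul_one_div, div_le_iff₀ (by positivity)]
          nlinarith [norm_nonneg x]
        change C * (2 * ‖x‖ + 1) * max (ε - 0) (0 - -ε) ≤ ‖x‖ + 1 - 0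
        simpa using h1
    obtain ⟨α, h0, hα⟩ := hpl.exists_eq_forall_mem_Icc_hasDerivWithinAt₀
    refine ⟨fun t ↦ (s + t, α t), by simpa using h0, fun t ht ↦ ?_⟩
    have h1 : HasDerivAt α (A (s + t) (α t)) t :=
      (hα t ⟨ht.1.le, ht.2.le⟩).hasDerivAt (Icc_mem_nhds ht.1 ht.2)
    have h2 : HasDerivAt (fun t ↦ (s + t, α t)) ((1, A (s + t) (α t)) : ℝ × F) t :=
      ((hasDerivAt_id t).const_add s).prodMk h1
    exact h2.hasFDerivAt.hasMFDerivAt.hasMFDerivWithinAt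
  obtain ⟨γ, h0, hγ⟩ := exists_isMIntegralCurve_of_isMIntegralCurveOn hv hε hloc (0, w₀)
  have hd : ∀ t, HasDerivAt γ ((1, A (γ t).1 (γ t).2) : ℝ × F) t := fun t ↦ by
    have h := (hγ t).hasFDerivAt
    have h' : HasFDerivAt γ ((1 : ℝ →L[ℝ] ℝ).smulRight ((1, A (γ t).1 (γ t).2) : ℝ × F)) t := h
    simpa using h'.hasDerivAt
  have h1 : ∀ t, (γ t).1 = t := by
    intro t
    have h2 : ∀ t, HasDerivAt (fun t ↦ (γ t).1 - t) 0 t := fun t ↦ by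
      have h3 : HasDerivAt (fun t ↦ (γ t).1) 1 t := 
        (hasFDerivAt_fst (𝕜 := ℝ) (E := ℝ) (F := F) (p := γ t)).comp_hasDerivAt t (hd t)
      simpa using h3.fun_sub (hasDerivAt_id' t)
    have h3 := is_const_of_deriv_eq_zero (fun t ↦ (h2 t).differentiableAt)
      (fun t ↦ (h2 t).deriv) t 0
    simp only [h0, sub_zero] at h3
    linarith
  refine ⟨fun t ↦ (γ t).2, congrArg Prod.snd h0, fun t ↦ ?_⟩
  have := (hd t).snd
  rwa [h1 t] at this

end LinearODE

/-! ### A finite spanning family of global vector fields -/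

section GlobalFrame

universe uM

variable {E : Type*} [NormedAddCommGroup E] [NormedSpace ℝ E] [FiniteDimensional ℝ E]
  {H : Type*} [TopologicalSpace H] {I : ModelWithCorners ℝ E H}
  {M : Type uM} [TopologicalSpace M] [ChartedSpace H M] [IsManifold I ∞ M]

/-- On a compact manifold finitely many smooth vector fields span every tangent space, with
coefficients that can be chosen linearly and smoothly. -/
theorem exists_finite_smooth_spanning [CompactSpace M] [T2Space M] :
    ∃ (K : Type uM) (_ : Fintype K) (X : K → ∀ x : M, TangentSpace I x)
      (l : K → ∀ x : M, TangentSpace I x →ₗ[ℝ] ℝ),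
      (∀ k, CMDiff ∞ (T% (X k))) ∧
      (∀ (Z : ∀ x : M, TangentSpace I x), CMDiff ∞ (T% Z) →
        ∀ k, CMDiff ∞ (fun x ↦ l k x (Z x))) ∧
      ∀ x (v : TangentSpace I x), v = ∑ k, l k x v • X k x := by
  obtain ⟨ι, f, -⟩ := SmoothBumpCovering.exists_isSubordinate I (s := (Set.univ : Set M))
    isClosed_univ (U := fun _ ↦ Set.univ) fun _ _ ↦ Filter.univ_mem
  let _ : Fintype ι := f.fintype
  let b := Module.finBasis ℝ E
  let e : ∀ i : ι, Trivialization E (TotalSpace.proj : TangentBundle I M → M) :=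
    fun i ↦ trivializationAt E (fun x : M ↦ TangentSpace I x) (f.c i)
  have he : ∀ i, (e i).baseSet = (chartAt H (f.c i)).source :=
    fun i ↦ TangentBundle.trivializationAt_baseSet _
  -- One factor `f i` cuts off the local frame, another cuts off its coefficients; dividing by `D`
  -- makes the products `f i ^ 2` sum to one.
  let D : M → ℝ := fun x ↦ ∑ i, f i x ^ 2
  have hD : CMDiff ∞ D := contMDiff_finsetSum fun i _ ↦ (f i).contMDiff.pow 2
  have hD0 : ∀ x, D x ≠ 0 := fun x ↦ by
    have h1 : 0 < f (f.ind x (Set.mem_univ x)) x ^ 2 := by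
      rw [f.apply_ind]
      norm_num
    exact (h1.trans_le (Finset.single_le_sum (f := fun i ↦ f i x ^ 2)
      (fun i _ ↦ sq_nonneg _) (Finset.mem_univ _))).ne'
  refine ⟨ι × Fin (Module.finrank ℝ E), inferInstance,
    fun k ↦ (f k.1 : M → ℝ) • (e k.1).localFrame b k.2,
    fun k x ↦ ((D x)⁻¹ * f k.1 x) • (e k.1).localFrameCoeff I b k.2 x, ?_, ?_, ?_⟩
  · rintro ⟨i, k⟩
    refine ContMDiffOn.smul_section_of_tsupport (u := (e i).baseSet) (f i).contMDiff.contMDiffOn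
      (e i).open_baseSet ?_ ((e i).contMDiffOn_localFrame_baseSet ∞ b k)
    rw [he]
    exact (f i).tsupport_subset_chartAt_source
  · rintro Z hZ ⟨i, k⟩
    have h1 : CMDiff ∞ (fun x ↦ f i x • (e i).localFrameCoeff I b k x (Z x)) := by
      refine (f i).contMDiff_smul ?_
      rw [← he]
      exact contMDiffOn_baseSet_localFrameCoeff b hZ.contMDiffOn k
    refine ((hD.inv₀ hD0).mul h1).congr fun x ↦ ?_
    simp [mul_assoc]
  · intro x v
    rw [Fintype.sum_prod_type]
    have h1 : ∀ i, ∑ k, (((D x)⁻¹ * f i x) • (e i).localFrameCoeff I b k x) v •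
        ((f i : M → ℝ) • (e i).localFrame b k) x = ((D x)⁻¹ * f i x ^ 2) • v := by
      intro i
      by_cases hx : x ∈ (e i).baseSet
      · have h2 : v = ∑ k, (e i).localFrameCoeff I b k x v • (e i).localFrame b k x := by
          have h3 := (e i).eq_sum_localFrameCoeff_smul (I := I) (b := b)
            (s := FiberBundle.extend E v) hx
          rwa [FiberBundle.extend_apply_self] at h3
        conv_rhs => rw [h2, Finset.smul_sum]
        refine Finset.sum_congr rfl fun k _ ↦ ?_
        simp only [LinearMap.smul_apply, smul_eq_mul, Pi.smul_apply', smul_smul]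
        ring_nf
      · have h2 : f i x = 0 := by
          by_contra h
          exact hx (he i ▸ (f i).support_subset_source h)
        simp [h2]
    simp only [h1]
    rw [← Finset.sum_smul, ← Finset.mul_sum]
    change v = ((D x)⁻¹ * D x) • v
    rw [inv_mul_cancel₀ (hD0 x), one_smul]

end GlobalFrame

/-! ### Parallel transport -/

section Parallel

universe uM

variable {E : Type*} [NormedAddCommGroup E] [NormedSpace ℝ E]
  {H : Type*} [TopologicalSpace H] {I : ModelWithCorners ℝ E H}
  {M : Type uM} [TopologicalSpace M] [ChartedSpace H M] [IsManifold I ∞ M]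
  {γ : ℝ → M} {K : Type*} [Fintype K] {X : K → ∀ x : M, TangentSpace I x} {w : K → ℝ → ℝ}

theorem contMDiff_two_sum_smul_comp (hγ : ContMDiff 𝓘(ℝ, ℝ) I 2 γ) (hX : ∀ k, CMDiff ∞ (T% (X k)))
    (hw : ∀ k, ContDiff ℝ 2 (w k)) :
    ContMDiff 𝓘(ℝ, ℝ) I.tangent 2
      (fun t ↦ (⟨γ t, ∑ k, w k t • X k (γ t)⟩ : TangentBundle I M)) := by
  intro t
  refine contMDiffAt_totalSpace.2 ⟨hγ t, ?_⟩
  let T := trivializationAt E (fun x : M ↦ TangentSpace I x) (γ t)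
  have hT : γ t ∈ T.baseSet := FiberBundle.mem_baseSet_trivializationAt' (γ t)
  have h1 : ∀ k, ContMDiffAt 𝓘(ℝ, ℝ) 𝓘(ℝ, E) 2 (fun s ↦ (T ⟨γ s, X k (γ s)⟩).2) t := fun k ↦
    ContMDiffAt.comp t (I' := I) (g := fun y ↦ (T ⟨y, X k y⟩).2)
      ((contMDiffAt_totalSpace.1 (hX k (γ t))).2.of_le (by norm_cast)) (hγ t)
  have h2 : ContMDiffAt 𝓘(ℝ, ℝ) 𝓘(ℝ, E) 2
      (fun s ↦ ∑ k, w k s • (T ⟨γ s, X k (γ s)⟩).2) t := by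
    refine ContDiffAt.contMDiffAt (ContDiffAt.sum fun k _ ↦ ?_)
    exact (hw k).contDiffAt.smul (h1 k).contDiffAt
  refine h2.congr_of_eventuallyEq ?_
  filter_upwards [hγ.continuous.continuousAt.preimage_mem_nhds (T.open_baseSet.mem_nhds hT)]
    with s hs
  have hs' : γ s ∈ T.baseSet := hs
  change (T ⟨γ s, ∑ k, w k s • X k (γ s)⟩).2 = _
  rw [← Trivialization.continuousLinearMapAt_apply_of_mem (R := ℝ) T hs', map_sum]
  refine Finset.sum_congr rfl fun k _ ↦ ?_
  rw [map_smul, Trivialization.continuousLinearMapAt_apply_of_mem (R := ℝ) T hs']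

variable [FiniteDimensional ℝ E] (g : SmoothMetric I M)

/-- The covariant derivative of a multiple of a parallel vector field along a curve. -/
theorem covDerivAlong_smul_parallel {w' : K → ℝ → ℝ} {f : ℝ → ℝ} {f' t : ℝ}
    (hγ : MDifferentiableAt 𝓘(ℝ, ℝ) I γ t) (hX : ∀ k, MDiffAt (T% (X k)) (γ t))
    (hw : ∀ k, HasDerivAt (w k) (w' k t) t)
    (hpar : ∑ k, (w' k t • X k (γ t) + w k t • leviCivita g (X k) (γ t) (velocity I γ t)) = 0)
    (hf : HasDerivAt f f' t) :
    covDerivAlong g γ (fun s ↦ ∑ k, (f s * w k s) • X k (γ s)) t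
      = ∑ k, (f' * w k t) • X k (γ t) := by
  rw [covDerivAlong_sum g hγ (fun k ↦ hf.fun_mul (hw k)) hX, ← add_zero (∑ k, _ • _),
    ← smul_zero (f t), ← hpar, Finset.smul_sum, ← Finset.sum_add_distrib]
  refine Finset.sum_congr rfl fun k _ ↦ ?_
  module

variable [Nontrivial E]

/-- Parallel transport along the integral curves of a vector field on a compact manifold. -/
theorem exists_parallel [CompactSpace M] [T2Space M] {ξ : ∀ x : M, TangentSpace I x}
    (hξ : CMDiff ∞ (T% ξ)) (hγ : ContMDiff 𝓘(ℝ, ℝ) I 2 γ) (hv : ∀ t, velocity I γ t = ξ (γ t))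
    (v₀ : TangentSpace I (γ 0)) :
    ∃ (K : Type uM) (_ : Fintype K) (X : K → ∀ x : M, TangentSpace I x) (w w' : K → ℝ → ℝ),
      (∀ k, CMDiff ∞ (T% (X k))) ∧ (∀ k, ContDiff ℝ 2 (w k)) ∧
      (∀ k t, HasDerivAt (w k) (w' k t) t) ∧ ∑ k, w k 0 • X k (γ 0) = v₀ ∧
      ∀ t, ∑ k, (w' k t • X k (γ t) + w k t • leviCivita g (X k) (γ t) (velocity I γ t)) = 0 := by
  obtain ⟨K, _, X, l, hX, hl, hsum⟩ := exists_finite_smooth_spanning (I := I) (M := M)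
  classical
  let Z : K → ∀ x : M, TangentSpace I x := fun k x ↦ leviCivita g (X k) x (ξ x)
  have hZ : ∀ k, CMDiff ∞ (T% (Z k)) := fun k x ↦ SmoothAt.leviCivita g (hξ x) (hX k x)
  let B : K → K → (K → ℝ) →L[ℝ] (K → ℝ) := fun j k ↦
    (ContinuousLinearMap.proj (R := ℝ) (φ := fun _ : K ↦ ℝ) k).smulRight (Pi.single j (1 : ℝ))
  -- The `X k` need not be independent, but `∇_ξ X k = ∑ j, l j (∇_ξ X k) • X j` still holds, so `u'
  -- = A u` with entries `-l j (∇_ξ X k)` is sufficient for `∑ k, u k • X k` to be parallel.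
  let A : M → (K → ℝ) →L[ℝ] (K → ℝ) := fun x ↦ ∑ j, ∑ k, (-l j x (Z k x)) • B j k
  have hAapply : ∀ x u j, A x u j = ∑ k, -(l j x (Z k x) * u k) := by
    intro x u j
    simp [A, B, Finset.sum_apply, Pi.single_apply]
  -- Since `A` is defined on all of the compact `M`, one bound serves for all times along `γ`.
  obtain ⟨C, hC⟩ := isCompact_univ.exists_bound_of_continuousOn (f := A) (Continuous.continuousOn <|
    continuous_finsetSum _ fun j _ ↦ continuous_finsetSum _ fun k _ ↦
      ((hl _ (hZ k) j).continuous.neg).smul continuous_const)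
  have hA : ContDiff ℝ 1 (fun t ↦ A (γ t)) := by
    refine ContDiff.sum fun j _ ↦ ContDiff.sum fun k _ ↦ ContDiff.fun_smul (ContDiff.neg ?_)
      contDiff_const
    exact (((hl _ (hZ k) j).of_le (by simp)).comp (hγ.of_le (by norm_num))).contDiff
  obtain ⟨u, hu0, hu⟩ := exists_forall_hasDerivAt_linear hA (fun t ↦ hC (γ t) (Set.mem_univ _))
    (fun k ↦ l k (γ 0) v₀)
  refine ⟨K, inferInstance, X, fun k t ↦ u t k, fun k t ↦ A (γ t) (u t) k, hX,
    fun k ↦ contDiff_pi.1 (contDiff_two_of_hasDerivAt_linear hA hu) k,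
    fun k t ↦ hasDerivAt_pi.1 (hu t) k, ?_, fun t ↦ ?_⟩
  · simp only [hu0]
    exact (hsum _ _).symm
  · rw [Finset.sum_add_distrib]
    simp only [hAapply, hv]
    have h1 : ∀ k, u t k • leviCivita g (X k) (γ t) (ξ (γ t))
        = ∑ j, (l j (γ t) (Z k (γ t)) * u t k) • X j (γ t) := by
      intro k
      change u t k • Z k (γ t) = _
      conv_lhs => rw [hsum _ (Z k (γ t)), Finset.smul_sum]
      refine Finset.sum_congr rfl fun j _ ↦ ?_
      rw [smul_smul, mul_comm]
    simp only [h1]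
    rw [Finset.sum_comm, ← Finset.sum_add_distrib]
    refine Finset.sum_eq_zero fun j _ ↦ ?_
    rw [Finset.sum_neg_distrib, neg_smul, Finset.sum_smul, neg_add_cancel]

end Parallel

/-! ### Conjugate points along Reeb orbits -/

namespace SasakianStructure

variable {E : Type*} [NormedAddCommGroup E] [NormedSpace ℝ E] [FiniteDimensional ℝ E]
  {H : Type*} [TopologicalSpace H] {I : ModelWithCorners ℝ E H}
  {M : Type*} [TopologicalSpace M] [ChartedSpace H M] [IsManifold I ∞ M] {g : SmoothMetric I M}
  (S : SasakianStructure g)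

/-- Vector fields that are parallel along the orbits of the Reeb field have constant `η`. -/
theorem eta_sum_eq_of_parallel {K : Type*} [Fintype K] {X : K → ∀ x : M, TangentSpace I x}
    {w w' : K → ℝ → ℝ} {γ : ℝ → M} (hγ : MDifferentiable 𝓘(ℝ, ℝ) I γ)
    (hv : ∀ t, velocity I γ t = S.xi (γ t)) (hX : ∀ k, CMDiff ∞ (T% (X k)))
    (hw : ∀ k t, HasDerivAt (w k) (w' k t) t)
    (hpar : ∀ t, ∑ k, (w' k t • X k (γ t)
      + w k t • leviCivita g (X k) (γ t) (velocity I γ t)) = 0) (t : ℝ) :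
    S.eta (γ t) (∑ k, w k t • X k (γ t)) = S.eta (γ 0) (∑ k, w k 0 • X k (γ 0)) := by
  have h1 : ∀ t, HasDerivAt (fun s ↦ S.eta (γ s) (∑ k, w k s • X k (γ s))) 0 t := by
    intro t
    have h2 : ∀ k, HasDerivAt (fun s ↦ S.eta (γ s) (X k (γ s)))
        (S.eta (γ t) (leviCivita g (X k) (γ t) (S.xi (γ t)))) t := by
      intro k
      have h3 : MDiffAt (fun y ↦ S.eta y (X k y)) (γ t) :=
        (S.contMDiffAt_eta (hX k (γ t))).mdifferentiableAt (by simp)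
      have h4 : HasFDerivAt ((fun y ↦ S.eta y (X k y)) ∘ γ)
          ((mvfderiv I (fun y ↦ S.eta y (X k y)) (γ t) : E →L[ℝ] ℝ).comp
            (mfderiv 𝓘(ℝ, ℝ) I γ t : ℝ →L[ℝ] E)) t :=
        (h3.hasMFDerivAt.comp t (hγ t).hasMFDerivAt).hasFDerivAt
      have h5 : HasDerivAt ((fun y ↦ S.eta y (X k y)) ∘ γ)
          (mvfderiv I (fun y ↦ S.eta y (X k y)) (γ t) (velocity I γ t)) t := h4.hasDerivAt
      have hξ := (S.smoothAt_xi (γ t)).mdiffAt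
      -- Because `∇_ξ ξ = 0`, differentiating `η(X k) = g(X k, ξ)` along the orbit only meets `∇_ξ
      -- (X k)`.
      have h6 := leviCivita_metric g hξ (SmoothAt.mdiffAt (hX k (γ t))) hξ
      rw [S.leviCivita_xi_xi, map_zero, add_zero, S.inner_xi] at h6
      simp only [S.inner_xi] at h6
      rwa [hv, h6] at h5
    have h7 := HasDerivAt.fun_sum (u := Finset.univ) fun k _ ↦ (hw k t).fun_mul (h2 k)
    convert! h7 using 1
    · ext s
      simp
    · rw [← map_zero (S.eta (γ t)), ← hpar t, map_sum]
      refine Finset.sum_congr rfl fun k _ ↦ ?_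
      simp [hv]
  exact is_const_of_deriv_eq_zero (fun t ↦ (h1 t).differentiableAt) (fun t ↦ (h1 t).deriv) t 0

/-- On a compact Sasakian manifold the orbits of the Reeb field are geodesics with conjugate
points. -/
theorem exists_areConjugate [CompactSpace M] [T2Space M] [BoundarylessManifold I M] {x₀ : M}
    {v₀ : TangentSpace I x₀} (hv₀ : v₀ ≠ 0) (hη : S.eta x₀ v₀ = 0) :
    ∃ γ : ℝ → M, IsGeodesic g γ ∧ AreConjugate g γ 0 Real.pi := by
  have : CompleteSpace E := FiniteDimensional.complete ℝ E
  have : Nontrivial E := ⟨⟨v₀, 0, hv₀⟩⟩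
  obtain ⟨γ, rfl, hγ⟩ := exists_isMIntegralCurve_of_compactSpace (I := I)
    (S.xi_smooth.of_le (by simp)) x₀
  have hγ2 : ContMDiff 𝓘(ℝ, ℝ) I 2 γ :=
    contMDiff_two_of_isMIntegralCurve (S.xi_smooth.of_le (by norm_cast)) hγ
  have hγd : MDifferentiable 𝓘(ℝ, ℝ) I γ := hγ2.mdifferentiable (by simp)
  have hvel : ∀ t, velocity I γ t = S.xi (γ t) := fun t ↦ by
    rw [velocity, (hγ t).mfderiv]
    exact one_smul ℝ (S.xi (γ t))
  have hgeo : IsGeodesic g γ := by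
    refine ⟨hγ2, fun t ↦ ?_⟩
    -- The velocity is the one-term combination `1 • ξ`, so its covariant derivative is `∇_ξ ξ = 0`.
    have h := covDerivAlong_sum g (ι := Unit) (w := fun _ _ ↦ 1) (w' := fun _ ↦ 0)
      (Y := fun _ ↦ S.xi) (hγd t) (fun _ ↦ hasDerivAt_const t 1)
      (fun _ ↦ (S.smoothAt_xi (γ t)).mdiffAt)
    rw [funext hvel]
    simpa [hvel, S.leviCivita_xi_xi] using h
  obtain ⟨K, _, X, w, w', hX, hw2, hw, h0, hpar⟩ := exists_parallel g S.xi_smooth hγ2 hvel v₀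
  have hXd : ∀ k t, MDiffAt (T% (X k)) (γ t) := fun k t ↦ SmoothAt.mdiffAt (hX k (γ t))
  -- The sine solves `f'' + f = 0`, the Jacobi equation for a multiple of a parallel field in
  -- curvature 1.
  let J : ∀ t, TangentSpace I (γ t) := fun t ↦ ∑ k, (Real.sin t * w k t) • X k (γ t)
  have hDJ : covDerivAlong g γ J = fun t ↦ ∑ k, (Real.cos t * w k t) • X k (γ t) := funext fun t ↦
    covDerivAlong_smul_parallel g (hγd t) (fun k ↦ hXd k t) (fun k ↦ hw k t) (hpar t)
      (Real.hasDerivAt_sin t)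
  have hDDJ : ∀ t, covDerivAlong g γ (covDerivAlong g γ J) t = -J t := by
    intro t
    rw [hDJ, covDerivAlong_smul_parallel g (hγd t) (fun k ↦ hXd k t) (fun k ↦ hw k t) (hpar t)
      (Real.hasDerivAt_cos t)]
    simp [J]
  have hJη : ∀ t, S.eta (γ t) (J t) = 0 := by
    intro t
    have h1 : J t = Real.sin t • ∑ k, w k t • X k (γ t) := by
      simp only [J, Finset.smul_sum, smul_smul]
    rw [h1, map_smul, S.eta_sum_eq_of_parallel hγd hvel hX hw hpar, h0, hη, smul_zero]
  refine ⟨γ, hgeo, Real.pi_pos.ne, J, ⟨?_, fun t ↦ ?_⟩, ?_, ?_, ?_⟩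
  · exact contMDiff_two_sum_smul_comp hγ2 hX fun k ↦ Real.contDiff_sin.mul (hw2 k)
  · rw [hDDJ, hvel, S.curvature_xi, hJη, zero_smul, sub_zero, neg_add_cancel]
  · by_contra! hJ
    -- The covariant derivative of `J` at `0` is `cos 0 • v₀ = v₀`. The empty sum shows that the
    -- zero field has zero derivative, so `J = 0` would force `v₀ = 0`.
    have h1 := covDerivAlong_sum g (ι := Empty) (w := fun _ _ ↦ 0) (w' := fun _ ↦ 0)
      (Y := fun _ ↦ S.xi) (hγd 0) (fun i ↦ i.elim) (fun i ↦ i.elim)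
    simp only [Finset.univ_eq_empty, Finset.sum_empty] at h1
    rw [← show J = fun _ ↦ 0 from funext hJ, hDJ] at h1
    simp only [Real.cos_zero, one_mul, h0] at h1
    exact hv₀ h1
  · simp [J]
  · simp [J]

end SasakianStructure

end RiemannianGeometry

end

theorem mainTheorem6 (S : Type*) [TopologicalSpace S] [T2Space S] [CompactSpace S]
    [ConnectedSpace S] [ChartedSpace (EuclideanSpace ℝ (Fin 2)) S] [IsManifold (𝓡 2) ∞ S]
    (hS : RiemannianGeometry.IsOrientable 2 S)
    (k : ℕ) (hgenus : RiemannianGeometry.HasGenus S k) (hk : 2 ≤ k) :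
    ¬ ∃ g : RiemannianGeometry.SmoothMetric ((𝓡 2).prod (𝓡 1)) (S × Circle),
      RiemannianGeometry.IsSasakian g ∧ RiemannianGeometry.NoConjugatePoints g := by
  rintro ⟨g, ⟨T⟩, hg⟩
  obtain ⟨p⟩ : Nonempty S := inferInstance
  let x₀ : S × Circle := (p, 1)
  have hdim : Module.finrank ℝ (TangentSpace ((𝓡 2).prod (𝓡 1)) x₀) = 3 := by
    change Module.finrank ℝ (EuclideanSpace ℝ (Fin 2) × EuclideanSpace ℝ (Fin 1)) = 3
    simp
  have : FiniteDimensional ℝ (TangentSpace ((𝓡 2).prod (𝓡 1)) x₀) :=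
    Module.finite_of_finrank_pos (by omega)
  -- A linear form on a space of dimension 3 has a nonzero kernel; this gives the initial direction
  -- orthogonal to the Reeb field.
  obtain ⟨v₀, hη, hv₀⟩ := (Submodule.ne_bot_iff _).1
    (LinearMap.ker_ne_bot_of_finrank_lt (f := (T.eta x₀).toLinearMap) (by simp [hdim]))
  obtain ⟨γ, hγ, hconj⟩ := T.exists_areConjugate hv₀ hη
  exact hg γ hγ _ _ hconj
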